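/- **Setting.** Let $X=X_0+C_0\in\mathbb R^{d\times n}$, where $X_0$ has rank $r_0\ge 1$ and compact singular value decomposition $X_0=U_0\Sigma_0V_0^T$, and let $X=U_X\Sigma_XV_X^T$ be a compact singular value decomposition of $X$ (only the positive singular values are kept, so $V_0$ has $r_0$ orthonormal columns). Let $\mathcal I_0$ be the column support of $C_0$, that is, the set of indices of its nonzero columns, and let $\gamma=|\mathcal I_0|/n$. Assume that $X_0$ and $C_0$ have disjoint column supports, i.e. the columns of $X_0$ with index in $\mathcal I_0$ are zero. Write $\|\cdot\|$ for the spectral norm, $\|\cdot\|_*$ for the nuclear norm (sum of the singular values) and $\|\cdot\|_{2,1}$ for the sum of the Euclidean norms of the columns. Assume further: * (relative well-definedness with parameter $\beta>0$) $\|\Sigma_X^{-1}V_X^TV_0\|\le \dfrac1{\beta\|X\|}$; * (column-incoherence with parameter $\mu$) $\max_{1\le i\le n}\|V_0^T\mathbf e_i\|_2^2\le \dfrac{\mu r_0}{(1-\gamma)n}$; * ($V_0$ lies in the row space of $X$) $V_XV_X^TV_0=V_0$. **Theorem.** Let $\gamma^*$ be defined by $$\frac{\gamma^*}{1-\gamma^*}=\frac{324\,\beta^2}{49\,(11+4\beta)^2\,\mu\,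 r_0},\qquad\text{and put}\qquad \lambda=\frac{3}{7\,\|X\|\sqrt{\gamma^*n}} .$$ If $\gamma\le\gamma^*$, then every optimal solution $(Z^*,C^*)$ of $$\min_{Z\in\mathbb R^{n\times n},\,C\in\mathbb R^{d\times n}}\ \|Z\|_*+\lambda\|C\|_{2,1}\quad\text{subject to}\quad X=XZ+C$$ satisfies $U^*(U^*)^T=V_0V_0^T$ and $\mathcal I^*=\mathcal I_0$, where $Z^*=U^*\Sigma^*(V^*)^T$ is any compact singular value decomposition of $Z^*$ and $\mathcal I^*$ is the column support of $C^*$. -/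

import Mathlib

open scoped Matrix Matrix.Norms.L2Operator

noncomputable section

namespace LRR

/-- The nuclear norm of a real `m × n` matrix: the sum of its singular values. -/
def nuclearNorm {m n : ℕ} (M : Matrix (Fin m) (Fin n) ℝ) : ℝ :=
  ∑ i : Fin n, (Matrix.toEuclideanLin M).singularValues i

/-- The Euclidean norm of the `i`-th column of `M`. -/
def colNorm {m n : ℕ} (M : Matrix (Fin m) (Fin n) ℝ) (i : Fin n) : ℝ :=
  ‖WithLp.toLp 2 (M.col i)‖

/-- The `ℓ_{2,1}` norm: the sum of the Euclidean norms of the columns. -/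
def norm21 {m n : ℕ} (M : Matrix (Fin m) (Fin n) ℝ) : ℝ :=
  ∑ i, colNorm M i

open Classical in
/-- The column support of `M`: the set of indices of its nonzero columns. -/
def colSupport {m n : ℕ} (M : Matrix (Fin m) (Fin n) ℝ) : Finset (Fin n) :=
  {i | M.col i ≠ 0}

/-- `M = U Σ Vᵀ` is a (compact) singular value decomposition: `U` and `V` have orthonormal
columns and `Σ = diag σ` with positive entries. Then `r` is the rank of `M`. The singular values
may be listed in any order. -/
structure IsSVD {m n r : ℕ} (M : Matrix (Fin m) (Fin n) ℝ)
    (U : Matrix (Fin m) (Fin r) ℝ) (σ : Fin r → ℝ) (V : Matrix (Fin n) (Fin r) ℝ) : Prop where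
  left_orthonormal : Uᵀ * U = 1
  right_orthonormal : Vᵀ * V = 1
  pos : ∀ k, 0 < σ k
  eq : M = U * Matrix.diagonal σ * Vᵀ

/-- `X`, with singular values `σX` and right singular vectors `VX`, is relatively well-defined
with parameter `β > 0`, with regard to a matrix with right singular vectors `V₀`:
`‖Σ_X⁻¹ V_Xᵀ V₀‖ ≤ 1 / (β ‖X‖)`, in the spectral norm. -/
def IsRWD {d n rX r₀ : ℕ} (X : Matrix (Fin d) (Fin n) ℝ) (σX : Fin rX → ℝ)
    (VX : Matrix (Fin n) (Fin rX) ℝ) (V₀ : Matrix (Fin n) (Fin r₀) ℝ) (β : ℝ) : Prop :=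
  0 < β ∧ ‖Matrix.diagonal (fun k => (σX k)⁻¹) * VXᵀ * V₀‖ ≤ 1 / (β * ‖X‖)

/-- Column-incoherence with parameter `μ`, for right singular vectors `V₀ : n × r₀` and a fraction
`γ` of outlier columns: `max_i ‖V₀ᵀ e_i‖² ≤ μ r₀ / ((1 - γ) n)`. -/
def IsColIncoherent {n r₀ : ℕ} (V₀ : Matrix (Fin n) (Fin r₀) ℝ) (γ μ : ℝ) : Prop :=
  ∀ i, colNorm V₀ᵀ i ^ 2 ≤ μ * r₀ / ((1 - γ) * n)

/-- `(Z, C)` is an optimal solution of `min ‖Z‖_* + lam ‖C‖_{2,1}` subject to `X = X Z + C`. -/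
def IsOptimal {d n : ℕ} (X : Matrix (Fin d) (Fin n) ℝ) (lam : ℝ)
    (Z : Matrix (Fin n) (Fin n) ℝ) (C : Matrix (Fin d) (Fin n) ℝ) : Prop :=
  X = X * Z + C ∧
    ∀ (Z' : Matrix (Fin n) (Fin n) ℝ) (C' : Matrix (Fin d) (Fin n) ℝ), X = X * Z' + C' →
      nuclearNorm Z + lam * norm21 C ≤ nuclearNorm Z' + lam * norm21 C'

end LRR

end

namespace LRR

open Matrix WithLp

/-! The proof is convex duality with a certificate built from an oracle problem. Write `I` for the
outlier columns and `P` for the projection onto them. The oracle restricts the program to `Z = V₀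
A`, `C = X - X V₀ A`, with the columns of `A` outside `I` frozen to those of `V₀ᵀ`. Its minimiser
exists by compactness and has residual exactly supported on `I`. With `S = (A Aᵀ)^(1/2)`, polar
factor `Y = S⁻¹ A` and normalised residual `H`, stationarity reads `Y P = lam (X V₀)ᵀ H`
(`oracle_first_order`).

From this `exists_dual_certificate` builds `Q` with `Xᵀ Q = V₀ Y + W`, where `V₀ᵀ W = 0`, `W Yᵀ =
0`, `‖W‖ < 1` and `Q P = lam H`. The choice of `lam` keeps `‖Y P‖` and the other interaction terms
at most `3/7`, which gives the strict bound on `W`. Incoherence makes the columns of `Q` outside `I`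
strictly shorter than `lam`.

Every feasible pair has objective at least `trace (Qᵀ X)`, and the oracle attains this value. So
every optimal pair attains equality in both trace inequalities. Strictness then forces the columns
of `Z` into the range of `V₀` (`proj_mul_eq_of_nuclearNorm_le`) and the support of `C` into `I`
(`col_eq_zero_of_norm21_le`). The reverse inclusions are linear algebra: the kernel of `X` is killed
by `V₀ᵀ`, and `V₀ᵀ` vanishes on `I`. -/

/-! ### Euclidean and spectral norms -/

theorem norm_toLp_sq {n : ℕ} (v : Fin n → ℝ) : ‖toLp 2 v‖ ^ 2 = v ⬝ᵥ v := by
  rw [EuclideanSpace.norm_sq_eq]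
  simp [dotProduct, pow_two]

theorem inner_eq_dotProduct {n : ℕ} (x y : EuclideanSpace ℝ (Fin n)) :
    inner ℝ x y = ofLp x ⬝ᵥ ofLp y := by
  simp [PiLp.inner_apply, dotProduct, mul_comm]

theorem dotProduct_le_norm_mul_norm {n : ℕ} (v w : Fin n → ℝ) :
    v ⬝ᵥ w ≤ ‖toLp 2 v‖ * ‖toLp 2 w‖ := by
  simpa [inner_eq_dotProduct] using real_inner_le_norm (toLp 2 v) (toLp 2 w)

theorem norm_mulVec_le {m n : ℕ} (A : Matrix (Fin m) (Fin n) ℝ) (x : Fin n → ℝ) :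
    ‖toLp 2 (A *ᵥ x)‖ ≤ ‖A‖ * ‖toLp 2 x‖ :=
  l2_opNorm_mulVec A (toLp 2 x)

theorem opNorm_le_of_mulVec {m n : ℕ} {A : Matrix (Fin m) (Fin n) ℝ} {c : ℝ} (hc : 0 ≤ c)
    (h : ∀ x, ‖toLp 2 (A *ᵥ x)‖ ≤ c * ‖toLp 2 x‖) : ‖A‖ ≤ c := by
  rw [l2_opNorm_def]
  refine ContinuousLinearMap.opNorm_le_bound _ hc fun x => ?_
  exact h (ofLp x)

theorem norm_transpose {m n : ℕ} (A : Matrix (Fin m) (Fin n) ℝ) : ‖Aᵀ‖ = ‖A‖ := by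
  simpa using l2_opNorm_conjTranspose A

theorem dotProduct_transpose_mulVec {m n : ℕ} (A : Matrix (Fin m) (Fin n) ℝ) (x : Fin m → ℝ)
    (y : Fin n → ℝ) : (Aᵀ *ᵥ x) ⬝ᵥ y = x ⬝ᵥ (A *ᵥ y) := by
  rw [dotProduct_mulVec, mulVec_transpose]

theorem norm_mulVec_of_orthonormal {m n : ℕ} {A : Matrix (Fin m) (Fin n) ℝ} (h : Aᵀ * A = 1)
    (x : Fin n → ℝ) : ‖toLp 2 (A *ᵥ x)‖ = ‖toLp 2 x‖ := by
  have : ‖toLp 2 (A *ᵥ x)‖ ^ 2 = ‖toLp 2 x‖ ^ 2 := by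
    rw [norm_toLp_sq, norm_toLp_sq, ← dotProduct_transpose_mulVec, mulVec_mulVec, h, one_mulVec]
  exact (sq_eq_sq₀ (norm_nonneg _) (norm_nonneg _)).1 this

theorem norm_le_one_of_orthonormal {m n : ℕ} {A : Matrix (Fin m) (Fin n) ℝ} (h : Aᵀ * A = 1) :
    ‖A‖ ≤ 1 :=
  opNorm_le_of_mulVec zero_le_one fun x => by rw [norm_mulVec_of_orthonormal h, one_mul]

theorem norm_mul_of_orthonormal {m n k : ℕ} {A : Matrix (Fin m) (Fin n) ℝ} (h : Aᵀ * A = 1)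
    (B : Matrix (Fin n) (Fin k) ℝ) : ‖A * B‖ ≤ ‖B‖ :=
  (l2_opNorm_mul A B).trans (by
    have := mul_le_mul_of_nonneg_right (norm_le_one_of_orthonormal h) (norm_nonneg B)
    simpa using this)

/-! ### Duality between the nuclear and spectral norms -/

theorem mulVec_eq_toEuclideanLin {m n : ℕ} (A : Matrix (Fin m) (Fin n) ℝ)
    (x : EuclideanSpace ℝ (Fin n)) : toLp 2 (A *ᵥ ofLp x) = toEuclideanLin A x := rfl

theorem trace_transpose_mul_eq_sum {m n : ℕ} (Y M : Matrix (Fin m) (Fin n) ℝ)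
    (b : OrthonormalBasis (Fin n) ℝ (EuclideanSpace ℝ (Fin n))) :
    trace (Yᵀ * M) = ∑ k, (Y *ᵥ ofLp (b k)) ⬝ᵥ (M *ᵥ ofLp (b k)) := by
  have h := LinearMap.trace_eq_sum_inner (toEuclideanLin (Yᵀ * M)) b
  have h2 : LinearMap.trace ℝ _ (toEuclideanLin (Yᵀ * M)) = trace (Yᵀ * M) := by
    rw [toEuclideanLin_eq_toLin_orthonormal, Matrix.trace_toLin_eq]
  rw [← h2, h]
  refine Finset.sum_congr rfl fun k _ => ?_
  rw [inner_eq_dotProduct, ← mulVec_eq_toEuclideanLin, ← mulVec_mulVec,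
    ← dotProduct_transpose_mulVec, transpose_transpose]

theorem trace_transpose_mul_eq_sum_col {m n : ℕ} (A B : Matrix (Fin m) (Fin n) ℝ) :
    trace (Aᵀ * B) = ∑ i, A.col i ⬝ᵥ B.col i := by
  simp [trace, Matrix.mul_apply, dotProduct]

/-- Eigenvectors of `MᵀM` are right singular vectors. Zero singular values are kept, so the basis is
full and traces can be expanded in it. -/
theorem exists_nuclear_basis {m n : ℕ} (M : Matrix (Fin m) (Fin n) ℝ) :
    ∃ b : OrthonormalBasis (Fin n) ℝ (EuclideanSpace ℝ (Fin n)),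
      nuclearNorm M = ∑ k, ‖toLp 2 (M *ᵥ ofLp (b k))‖ ∧
      ∀ j k, j ≠ k → (M *ᵥ ofLp (b j)) ⬝ᵥ (M *ᵥ ofLp (b k)) = 0 := by
  set T := toEuclideanLin M with hT
  have hn : Module.finrank ℝ (EuclideanSpace ℝ (Fin n)) = n := by simp
  set b := T.isSymmetric_adjoint_comp_self.eigenvectorBasis hn with hb
  have key : ∀ j k, inner ℝ (T (b j)) (T (b k)) =
      T.isSymmetric_adjoint_comp_self.eigenvalues hn k * inner ℝ (b j) (b k) := by
    intro j k
    have := T.isSymmetric_adjoint_comp_self.apply_eigenvectorBasis hn k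
    rw [← LinearMap.adjoint_inner_right, ← LinearMap.comp_apply, this, inner_smul_right]
    simp [hb]
  refine ⟨b, ?_, fun j k hjk => ?_⟩
  · refine Finset.sum_congr rfl fun k _ => ?_
    rw [← hT, mulVec_eq_toEuclideanLin, ← hT]
    have h1 : ‖T (b k)‖ ^ 2 = T.singularValues k ^ 2 := by
      rw [← real_inner_self_eq_norm_sq, key, T.sq_singularValues_fin hn k]
      simp
    exact ((sq_eq_sq₀ (norm_nonneg _) (T.singularValues_nonneg k)).1 h1).symm
  · have := key j k
    rw [inner_eq_dotProduct] at this
    simpa [b.inner_eq_zero hjk, hT] using this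

theorem norm_basis {n : ℕ} (b : OrthonormalBasis (Fin n) ℝ (EuclideanSpace ℝ (Fin n)))
    (k : Fin n) : ‖toLp 2 (ofLp (b k))‖ = 1 := b.norm_eq_one k

theorem norm_mulVec_basis_le {m n : ℕ} {Y : Matrix (Fin m) (Fin n) ℝ} (hY : ‖Y‖ ≤ 1)
    (b : OrthonormalBasis (Fin n) ℝ (EuclideanSpace ℝ (Fin n))) (k : Fin n) :
    ‖toLp 2 (Y *ᵥ ofLp (b k))‖ ≤ 1 := by
  have := norm_mulVec_le Y (ofLp (b k))
  rw [norm_basis, mul_one] at this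
  exact this.trans hY

theorem trace_le_nuclearNorm {m n : ℕ} {Y : Matrix (Fin m) (Fin n) ℝ} (hY : ‖Y‖ ≤ 1)
    (M : Matrix (Fin m) (Fin n) ℝ) : trace (Yᵀ * M) ≤ nuclearNorm M := by
  obtain ⟨b, hb, -⟩ := exists_nuclear_basis M
  rw [hb, trace_transpose_mul_eq_sum Y M b]
  refine Finset.sum_le_sum fun k _ => (dotProduct_le_norm_mul_norm _ _).trans ?_
  exact mul_le_of_le_one_left (norm_nonneg _) (norm_mulVec_basis_le hY b k)

/-- `Y` is the partial isometry sending each right singular vector to its normalised image. Since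
`0⁻¹ = 0`, it vanishes on those with zero image. -/
theorem exists_trace_eq_nuclearNorm {m n : ℕ} (M : Matrix (Fin m) (Fin n) ℝ) :
    ∃ Y : Matrix (Fin m) (Fin n) ℝ, ‖Y‖ ≤ 1 ∧ trace (Yᵀ * M) = nuclearNorm M := by
  obtain ⟨b, hb, horth⟩ := exists_nuclear_basis M
  set u : Fin n → EuclideanSpace ℝ (Fin m) := fun k =>
    ‖toLp 2 (M *ᵥ ofLp (b k))‖⁻¹ • toLp 2 (M *ᵥ ofLp (b k)) with hu
  have hu1 : ∀ k, ‖u k‖ ≤ 1 := by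
    intro k
    simp only [hu, norm_smul, norm_inv, norm_norm]
    exact inv_mul_le_one
  have huo : ∀ j k, j ≠ k → inner ℝ (u j) (u k) = 0 := by
    intro j k hjk
    simp only [hu, inner_smul_left, inner_smul_right, inner_eq_dotProduct, horth j k hjk]
    simp
  set T : EuclideanSpace ℝ (Fin n) →ₗ[ℝ] EuclideanSpace ℝ (Fin m) :=
    b.toBasis.constr ℝ u with hT
  have hTb : ∀ k, T (b k) = u k := by
    intro k
    rw [hT, ← b.coe_toBasis, Module.Basis.constr_basis]
  have hYT : ∀ x, toLp 2 ((toEuclideanLin.symm T) *ᵥ ofLp x) = T x := by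
    intro x
    rw [mulVec_eq_toEuclideanLin, LinearEquiv.apply_symm_apply]
  refine ⟨toEuclideanLin.symm T, ?_, ?_⟩
  · refine opNorm_le_of_mulVec zero_le_one fun x => ?_
    have hx := hYT (toLp 2 x)
    rw [ofLp_toLp] at hx
    rw [hx, one_mul]
    set y : EuclideanSpace ℝ (Fin n) := toLp 2 x
    have hTy : T y = ∑ k, inner ℝ (b k) y • u k := by
      conv_lhs => rw [← b.sum_repr' y]
      rw [map_sum]
      simp [hTb]
    have h1 : ‖T y‖ ^ 2 = ∑ k, inner ℝ (b k) y ^ 2 * ‖u k‖ ^ 2 := by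
      rw [← real_inner_self_eq_norm_sq, hTy, sum_inner]
      refine Finset.sum_congr rfl fun k _ => ?_
      rw [inner_sum, Finset.sum_eq_single k]
      · rw [real_inner_smul_left, real_inner_smul_right, real_inner_self_eq_norm_sq]; ring
      · intro j _ hjk
        rw [real_inner_smul_left, real_inner_smul_right, huo k j hjk.symm]; simp
      · simp
    have h2 : ‖y‖ ^ 2 = ∑ k, inner ℝ (b k) y ^ 2 := by
      rw [← b.sum_sq_norm_inner_right y]; simp
    refine le_of_sq_le_sq ?_ (norm_nonneg _)
    rw [h1, h2]
    refine Finset.sum_le_sum fun k _ => mul_le_of_le_one_right (sq_nonneg _) ?_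
    exact pow_le_one₀ (norm_nonneg _) (hu1 k)
  · rw [trace_transpose_mul_eq_sum _ M b, hb]
    refine Finset.sum_congr rfl fun k _ => ?_
    have := hYT (b k)
    rw [hTb] at this
    have h3 : (toEuclideanLin.symm T) *ᵥ ofLp (b k) = ofLp (u k) := by rw [← this]
    rw [h3]
    simp only [hu, ofLp_smul, smul_dotProduct, smul_eq_mul]
    rw [← norm_toLp_sq]
    by_cases h0 : ‖toLp 2 (M *ᵥ ofLp (b k))‖ = 0
    · rw [h0]; simp
    · field_simp

theorem norm_transpose_mulVec_le {m k : ℕ} {Y : Matrix (Fin m) (Fin k) ℝ} (hY : ‖Y‖ ≤ 1)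
    (x : Fin m → ℝ) : ‖toLp 2 (Yᵀ *ᵥ x)‖ ≤ ‖toLp 2 x‖ := by
  refine (norm_mulVec_le _ _).trans ?_
  rw [norm_transpose]
  exact mul_le_of_le_one_left (norm_nonneg _) hY

/-! ### Existence of an oracle minimiser -/

theorem norm_apply_le {n : ℕ} (x : Fin n → ℝ) (i : Fin n) : |x i| ≤ ‖toLp 2 x‖ := by
  simpa using PiLp.norm_apply_le (toLp 2 x) i

theorem norm_single_le {m n : ℕ} (j : Fin m) (i : Fin n) {s : ℝ} (hs : |s| ≤ 1) :
    ‖(single j i s : Matrix (Fin m) (Fin n) ℝ)‖ ≤ 1 := by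
  refine opNorm_le_of_mulVec zero_le_one fun x => ?_
  rw [single_mulVec, one_mul]
  have : toLp 2 (Function.update (0 : Fin m → ℝ) j (s * x i)) =
      EuclideanSpace.single j (s * x i) := by
    ext k; simp [Function.update_apply]
  rw [this]
  simp only [PiLp.norm_single, norm_mul, Real.norm_eq_abs]
  exact (mul_le_of_le_one_left (abs_nonneg _) hs).trans (norm_apply_le x i)

/-- Pairing with `V` times a signed matrix unit reads off one entry. This supplies the coercivity of
the oracle objective. -/
theorem abs_entry_le_nuclearNorm {m n r : ℕ} {V : Matrix (Fin m) (Fin r) ℝ} (hV : Vᵀ * V = 1)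
    (A : Matrix (Fin r) (Fin n) ℝ) (j : Fin r) (i : Fin n) : |A j i| ≤ nuclearNorm (V * A) := by
  have key : ∀ s : ℝ, |s| ≤ 1 → s * A j i ≤ nuclearNorm (V * A) := by
    intro s hs
    have h := trace_le_nuclearNorm
      ((norm_mul_of_orthonormal hV _).trans (norm_single_le j i hs)) (V * A)
    rw [transpose_mul, Matrix.mul_assoc, ← Matrix.mul_assoc Vᵀ, hV, Matrix.one_mul,
      transpose_single, trace_single_mul] at h
    simpa using h
  rw [abs_le']
  exact ⟨by simpa using key 1 (by simp), by simpa using key (-1) (by simp)⟩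

theorem colNorm_nonneg {m n : ℕ} (M : Matrix (Fin m) (Fin n) ℝ) (i : Fin n) : 0 ≤ colNorm M i :=
  norm_nonneg _

theorem norm21_nonneg {m n : ℕ} (M : Matrix (Fin m) (Fin n) ℝ) : 0 ≤ norm21 M :=
  Finset.sum_nonneg fun i _ => colNorm_nonneg M i

theorem continuous_norm21 {m n : ℕ} :
    Continuous (norm21 : Matrix (Fin m) (Fin n) ℝ → ℝ) := by
  unfold norm21 colNorm
  refine continuous_finsetSum _ fun i _ => ?_
  refine continuous_norm.comp ((PiLp.continuous_toLp 2 _).comp ?_)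
  exact continuous_pi fun j => continuous_id.matrix_elem j i

/-- By duality the nuclear norm is a supremum of continuous linear functionals. -/
theorem lowerSemicontinuous_nuclearNorm {m n : ℕ} :
    LowerSemicontinuous (nuclearNorm : Matrix (Fin m) (Fin n) ℝ → ℝ) := by
  intro M y hy
  obtain ⟨Y, hY, hYM⟩ := exists_trace_eq_nuclearNorm M
  rw [← hYM] at hy
  have hc : Continuous fun N : Matrix (Fin m) (Fin n) ℝ => trace (Yᵀ * N) :=
    (continuous_const.matrix_mul continuous_id).matrix_trace
  filter_upwards [hc.continuousAt.eventually (lt_mem_nhds hy)] with N hN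
  exact hN.trans_le (trace_le_nuclearNorm hY N)

/-- The objective of the low-rank representation program restricted to `Z = V A`,
`C = X - L A`. -/
noncomputable def oracleObjective {m d n r : ℕ} (V : Matrix (Fin m) (Fin r) ℝ) (L : Matrix (Fin d) (Fin r) ℝ)
    (X : Matrix (Fin d) (Fin n) ℝ) (lam : ℝ) (A : Matrix (Fin r) (Fin n) ℝ) : ℝ :=
  nuclearNorm (V * A) + lam * norm21 (X - L * A)

theorem exists_oracle_minimizer {m d n r : ℕ} {V : Matrix (Fin m) (Fin r) ℝ} (hV : Vᵀ * V = 1)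
    (L : Matrix (Fin d) (Fin r) ℝ) (X : Matrix (Fin d) (Fin n) ℝ) {lam : ℝ} (hlam : 0 ≤ lam)
    (I : Finset (Fin n)) (A₀ : Matrix (Fin r) (Fin n) ℝ) :
    ∃ A : Matrix (Fin r) (Fin n) ℝ, (∀ i ∉ I, A.col i = A₀.col i) ∧
      ∀ A' : Matrix (Fin r) (Fin n) ℝ, (∀ i ∉ I, A'.col i = A₀.col i) →
        oracleObjective V L X lam A ≤ oracleObjective V L X lam A' := by
  set f := oracleObjective V L X lam with hf
  have hbd : ∀ A j i, |A j i| ≤ f A := fun A j i =>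
    (abs_entry_le_nuclearNorm hV A j i).trans
      (le_add_of_nonneg_right (mul_nonneg hlam (norm21_nonneg _)))
  set F : Set (Matrix (Fin r) (Fin n) ℝ) := {A | ∀ i ∉ I, A.col i = A₀.col i} with hF
  set B : Set (Matrix (Fin r) (Fin n) ℝ) :=
    Set.univ.pi fun _ => Set.univ.pi fun _ => Set.Icc (-f A₀) (f A₀) with hB
  have hBc : IsCompact B := isCompact_univ_pi fun _ => isCompact_univ_pi fun _ => isCompact_Icc
  have hFc : IsClosed F := by
    simp only [hF, Set.ofPred_forall]
    refine isClosed_iInter fun i => isClosed_iInter fun _ => isClosed_eq ?_ continuous_const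
    exact continuous_pi fun j => continuous_id.matrix_elem j i
  have hB_of : ∀ A, f A ≤ f A₀ → A ∈ B := fun A hA j _ i _ =>
    abs_le.1 ((hbd A j i).trans hA)
  have hlsc : LowerSemicontinuous f := by
    refine LowerSemicontinuous.add ?_ (Continuous.lowerSemicontinuous ?_)
    · have hc : Continuous fun A : Matrix (Fin r) (Fin n) ℝ => V * A :=
        continuous_const.matrix_mul continuous_id
      exact fun A y hy => hc.continuousAt.eventually (lowerSemicontinuous_nuclearNorm (V * A) y hy)
    · exact continuous_const.mul (continuous_norm21.comp
        (continuous_const.sub (continuous_const.matrix_mul continuous_id)))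
  obtain ⟨A, hA, hmin⟩ := LowerSemicontinuousOn.exists_isMinOn (f := f) (s := F ∩ B)
    ⟨A₀, fun _ _ => rfl, hB_of A₀ le_rfl⟩ (hBc.inter_left hFc) (hlsc.lowerSemicontinuousOn _)
  refine ⟨A, hA.1, fun A' hA' => ?_⟩
  by_cases h : f A' ≤ f A₀
  · exact hmin ⟨hA', hB_of A' h⟩
  · exact (hmin ⟨fun _ _ => rfl, hB_of A₀ le_rfl⟩ : f A ≤ f A₀).trans (le_of_not_ge h)

/-! ### Quadratic majorant of the nuclear norm and polar factor -/

theorem trace_transpose_mul_self_eq {m n : ℕ} (A : Matrix (Fin m) (Fin n) ℝ) :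
    trace (Aᵀ * A) = ∑ i, colNorm A i ^ 2 := by
  rw [trace_transpose_mul_eq_sum_col]
  exact Finset.sum_congr rfl fun i _ => (norm_toLp_sq _).symm

theorem col_mul {m n k : ℕ} (A : Matrix (Fin m) (Fin n) ℝ) (B : Matrix (Fin n) (Fin k) ℝ)
    (i : Fin k) : (A * B).col i = A *ᵥ B.col i := rfl

theorem trace_conj_le_trace {r n : ℕ} {S : Matrix (Fin r) (Fin r) ℝ} (hS : S.PosSemidef)
    {Y : Matrix (Fin r) (Fin n) ℝ} (hY : ‖Y‖ ≤ 1) : trace (Yᵀ * S * Y) ≤ trace S := by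
  open scoped MatrixOrder in
  obtain ⟨Q, rfl⟩ : ∃ Q : Matrix (Fin r) (Fin r) ℝ, S = Qᵀ * Q :=
    CStarAlgebra.nonneg_iff_eq_star_mul_self.mp hS.nonneg
  have h1 : trace (Yᵀ * (Qᵀ * Q) * Y) = trace ((Yᵀ * Qᵀ)ᵀ * (Yᵀ * Qᵀ)) := by
    rw [transpose_mul, transpose_transpose, transpose_transpose, Matrix.trace_mul_comm (Q * Y)]
    simp only [Matrix.mul_assoc]
  have h2 : trace (Qᵀ * Q) = trace (Qᵀᵀ * Qᵀ) := by
    rw [Matrix.trace_mul_comm, transpose_transpose]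
  rw [h1, h2, trace_transpose_mul_self_eq, trace_transpose_mul_self_eq]
  refine Finset.sum_le_sum fun i _ => pow_le_pow_left₀ (colNorm_nonneg _ _) ?_ 2
  exact norm_transpose_mulVec_le hY _

/-- Take a dual optimal `Y'`, set `Y = Vᵀ Y'`, and expand `trace ((S⁻¹A - Y)ᵀ S (S⁻¹A - Y)) ≥ 0`.
The bound is an equality at `S = (A Aᵀ)^(1/2)`, so it serves as a smooth majorant. -/
theorem two_mul_nuclearNorm_mul_le {m n r : ℕ} {V : Matrix (Fin m) (Fin r) ℝ} (hV : Vᵀ * V = 1)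
    {S : Matrix (Fin r) (Fin r) ℝ} (hS : S.PosDef) (A : Matrix (Fin r) (Fin n) ℝ) :
    2 * nuclearNorm (V * A) ≤ trace (Aᵀ * S⁻¹ * A) + trace S := by
  obtain ⟨Y', hY', h⟩ := exists_trace_eq_nuclearNorm (V * A)
  have hSt : Sᵀ = S := by simpa [IsHermitian] using hS.isHermitian
  have hSu : IsUnit S.det := (isUnit_iff_isUnit_det S).1 hS.isUnit
  obtain ⟨Y, hYdef⟩ : ∃ Y, Y = Vᵀ * Y' := ⟨_, rfl⟩
  have hY : ‖Y‖ ≤ 1 := by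
    rw [hYdef]
    refine (l2_opNorm_mul _ _).trans ?_
    rw [norm_transpose]
    exact mul_le_one₀ (norm_le_one_of_orthonormal hV) (norm_nonneg _) hY'
  have h' : trace (Yᵀ * A) = nuclearNorm (V * A) := by
    rw [← h, hYdef, transpose_mul, transpose_transpose, Matrix.mul_assoc]
  have hpos : 0 ≤ trace ((S⁻¹ * A - Y)ᵀ * S * (S⁻¹ * A - Y)) := by
    have := hS.posSemidef.conjTranspose_mul_mul_same (S⁻¹ * A - Y)
    simpa using this.trace_nonneg
  have hexp : (S⁻¹ * A - Y)ᵀ * S * (S⁻¹ * A - Y) =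
      Aᵀ * S⁻¹ * A - Yᵀ * A - (Yᵀ * A)ᵀ + Yᵀ * S * Y := by
    have e1 : (S⁻¹ * A - Y)ᵀ * S = Aᵀ - Yᵀ * S := by
      rw [transpose_sub, transpose_mul, transpose_nonsing_inv, hSt, Matrix.sub_mul,
        Matrix.mul_assoc, nonsing_inv_mul _ hSu, Matrix.mul_one]
    have e2 : Yᵀ * S * (S⁻¹ * A) = Yᵀ * A := by
      rw [Matrix.mul_assoc, ← Matrix.mul_assoc S, mul_nonsing_inv _ hSu, Matrix.one_mul]
    rw [e1, Matrix.mul_sub, Matrix.sub_mul, Matrix.sub_mul, e2, transpose_mul, transpose_transpose,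
      ← Matrix.mul_assoc]
    abel
  rw [hexp, trace_add, trace_sub, trace_sub, trace_transpose, h'] at hpos
  linarith [trace_conj_le_trace hS.posSemidef hY]

/-- `S` is the square root of `A Aᵀ`. As `Aᵀ` never shortens vectors, neither does `S`, so `S` is
invertible with contractive inverse. This later bounds columns of `S⁻¹ A` by columns of `V₀ᵀ`. -/
theorem exists_polar {r n : ℕ} (A : Matrix (Fin r) (Fin n) ℝ)
    (hA : ∀ x, ‖toLp 2 x‖ ≤ ‖toLp 2 (Aᵀ *ᵥ x)‖) :
    ∃ S : Matrix (Fin r) (Fin r) ℝ, S.PosDef ∧ S * S = A * Aᵀ ∧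
      ∀ x, ‖toLp 2 (S⁻¹ *ᵥ x)‖ ≤ ‖toLp 2 x‖ := by
  have hK : (A * Aᵀ).PosSemidef := by
    simpa using posSemidef_self_mul_conjTranspose A
  open scoped MatrixOrder in
  obtain ⟨S, hS, hSS⟩ : ∃ S : Matrix (Fin r) (Fin r) ℝ, S.PosSemidef ∧ S * S = A * Aᵀ :=
    ⟨CFC.sqrt (A * Aᵀ), (CFC.sqrt_nonneg _).posSemidef, CFC.sqrt_mul_sqrt_self _ hK.nonneg⟩
  have hSt : Sᵀ = S := by simpa [IsHermitian] using hS.isHermitian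
  have hle : ∀ x, ‖toLp 2 x‖ ≤ ‖toLp 2 (S *ᵥ x)‖ := by
    intro x
    have : ‖toLp 2 (S *ᵥ x)‖ ^ 2 = ‖toLp 2 (Aᵀ *ᵥ x)‖ ^ 2 := by
      rw [norm_toLp_sq, norm_toLp_sq, ← dotProduct_transpose_mulVec, ← dotProduct_transpose_mulVec,
        mulVec_mulVec, mulVec_mulVec, hSt, transpose_transpose, hSS]
    rw [(sq_eq_sq₀ (norm_nonneg _) (norm_nonneg _)).1 this]
    exact hA x
  have hSu : IsUnit S := by
    rw [← mulVec_injective_iff_isUnit, ← coe_mulVecLin, ← LinearMap.ker_eq_bot,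
      LinearMap.ker_eq_bot']
    intro x hx
    have h := hle x
    rw [← mulVecLin_apply, hx] at h
    simpa using h
  refine ⟨S, ?_, hSS, fun x => ?_⟩
  · exact hS.posDef_iff_isUnit.2 hSu
  · have h := hle (S⁻¹ *ᵥ x)
    rwa [mulVec_mulVec, mul_nonsing_inv _ ((isUnit_iff_isUnit_det S).1 hSu), one_mulVec] at h

/-! ### Column projections and the tangent bound for the column norm -/

/-- The diagonal projection onto the coordinates in `I`. -/
def coordProj {n : ℕ} (I : Finset (Fin n)) : Matrix (Fin n) (Fin n) ℝ :=
  diagonal fun i => if i ∈ I then 1 else 0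

theorem coordProj_transpose {n : ℕ} (I : Finset (Fin n)) : (coordProj I)ᵀ = coordProj I :=
  diagonal_transpose _

theorem coordProj_mul_self {n : ℕ} (I : Finset (Fin n)) :
    coordProj I * coordProj I = coordProj I := by
  rw [coordProj, diagonal_mul_diagonal]
  congr 1; ext i; split_ifs <;> simp

theorem col_mul_coordProj_of_mem {m n : ℕ} {I : Finset (Fin n)} (M : Matrix (Fin m) (Fin n) ℝ)
    {i : Fin n} (hi : i ∈ I) : (M * coordProj I).col i = M.col i := by
  ext j; simp [coordProj, hi]

theorem col_mul_coordProj_of_notMem {m n : ℕ} {I : Finset (Fin n)}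
    (M : Matrix (Fin m) (Fin n) ℝ) {i : Fin n} (hi : i ∉ I) : (M * coordProj I).col i = 0 := by
  ext j; simp [coordProj, hi]

theorem ext_of_col {m n : ℕ} {A B : Matrix (Fin m) (Fin n) ℝ} (h : ∀ i, A.col i = B.col i) :
    A = B := by
  ext j i; exact congrFun (h i) j

/-- The matrix of normalised columns of `C`, with zero columns kept. -/
noncomputable def colNormalize {m n : ℕ} (C : Matrix (Fin m) (Fin n) ℝ) :
    Matrix (Fin m) (Fin n) ℝ :=
  C * diagonal fun i => (colNorm C i)⁻¹

theorem colNormalize_col {m n : ℕ} (C : Matrix (Fin m) (Fin n) ℝ) (i : Fin n) :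
    (colNormalize C).col i = (colNorm C i)⁻¹ • C.col i := by
  ext j; simp [colNormalize, mul_comm]

theorem colNorm_eq_zero {m n : ℕ} {C : Matrix (Fin m) (Fin n) ℝ} {i : Fin n} :
    colNorm C i = 0 ↔ C.col i = 0 := by
  simp [colNorm]

theorem colNorm_sq {m n : ℕ} (C : Matrix (Fin m) (Fin n) ℝ) (i : Fin n) :
    colNorm C i ^ 2 = C.col i ⬝ᵥ C.col i := norm_toLp_sq _

theorem colNorm_colNormalize_le {m n : ℕ} (C : Matrix (Fin m) (Fin n) ℝ) (i : Fin n) :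
    colNorm (colNormalize C) i ≤ 1 := by
  have : colNorm (colNormalize C) i = (colNorm C i)⁻¹ * colNorm C i := by
    rw [colNorm, colNormalize_col, toLp_smul, norm_smul, norm_inv, Real.norm_eq_abs,
      abs_of_nonneg (colNorm_nonneg C i)]
    rfl
  rw [this]
  exact inv_mul_le_one

theorem trace_colNormalize_mul {m n : ℕ} (C : Matrix (Fin m) (Fin n) ℝ) :
    trace ((colNormalize C)ᵀ * C) = norm21 C := by
  rw [trace_transpose_mul_eq_sum_col, norm21]
  refine Finset.sum_congr rfl fun i _ => ?_
  rw [colNormalize_col, smul_dotProduct, ← colNorm_sq, smul_eq_mul]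
  by_cases h : colNorm C i = 0
  · rw [h]; simp
  · field_simp

/-- The right side is `(‖x‖² + ‖c‖²) / (2‖c‖)`, so this is the arithmetic-geometric mean inequality.
At `c = 0` both sides vanish by hypothesis. -/
theorem norm_le_tangent {m : ℕ} {c x : Fin m → ℝ} (h : c = 0 → x = 0) :
    ‖toLp 2 x‖ ≤ ‖toLp 2 c‖ + ‖toLp 2 c‖⁻¹ * (c ⬝ᵥ (x - c)) +
      ‖toLp 2 c‖⁻¹ / 2 * ‖toLp 2 (x - c)‖ ^ 2 := by
  by_cases hc : c = 0
  · simp [hc, h hc]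
  · have hpos : 0 < ‖toLp 2 c‖ := by simpa using hc
    have e : ‖toLp 2 x‖ ^ 2 =
        ‖toLp 2 c‖ ^ 2 + 2 * (c ⬝ᵥ (x - c)) + ‖toLp 2 (x - c)‖ ^ 2 := by
      simp only [norm_toLp_sq, dotProduct_sub, sub_dotProduct, dotProduct_comm x c]; ring
    have : ‖toLp 2 c‖ + ‖toLp 2 c‖⁻¹ * (c ⬝ᵥ (x - c)) +
      ‖toLp 2 c‖⁻¹ / 2 * ‖toLp 2 (x - c)‖ ^ 2 =
        (‖toLp 2 x‖ ^ 2 + ‖toLp 2 c‖ ^ 2) / (2 * ‖toLp 2 c‖) := by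
      rw [e]; field_simp; ring
    rw [this, le_div_iff₀ (by positivity)]
    nlinarith [sq_nonneg (‖toLp 2 x‖ - ‖toLp 2 c‖)]

theorem norm21_le_tangent {m n : ℕ} (C E : Matrix (Fin m) (Fin n) ℝ)
    (h : ∀ i, C.col i = 0 → E.col i = 0) :
    ∃ a : ℝ, ∀ t : ℝ, norm21 (C - t • E) ≤
      norm21 C - t * trace ((colNormalize C)ᵀ * E) + t ^ 2 * a := by
  refine ⟨∑ i, (colNorm C i)⁻¹ / 2 * colNorm E i ^ 2, fun t => ?_⟩
  rw [trace_transpose_mul_eq_sum_col, norm21, norm21, Finset.mul_sum, Finset.mul_sum,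
    ← Finset.sum_sub_distrib, ← Finset.sum_add_distrib]
  refine Finset.sum_le_sum fun i _ => ?_
  have hcol : (C - t • E).col i = C.col i - t • E.col i := rfl
  have key := norm_le_tangent (c := C.col i) (x := C.col i - t • E.col i)
    (fun h0 => by simp [h0, h i h0])
  rw [sub_sub_cancel_left, ← smul_neg, dotProduct_smul, dotProduct_neg, toLp_smul, norm_smul,
    toLp_neg, norm_neg, mul_pow, Real.norm_eq_abs, sq_abs] at key
  rw [colNorm, hcol, colNormalize_col, smul_dotProduct]
  refine key.trans (le_of_eq ?_)
  simp only [colNorm, smul_eq_mul]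
  ring

theorem eq_zero_of_forall_mul_add_sq_nonneg {a b : ℝ} (h : ∀ t : ℝ, 0 ≤ t * a + t ^ 2 * b) :
    a = 0 := by
  by_contra ha
  have hb : 0 < |b| + 1 := by positivity
  -- A small step against the sign of `a`, for which the linear term dominates.
  have := h (-(a / (2 * (|b| + 1))))
  have h2 : -(a / (2 * (|b| + 1))) * a + (-(a / (2 * (|b| + 1)))) ^ 2 * b =
      a ^ 2 / (4 * (|b| + 1) ^ 2) * (b - 2 * (|b| + 1)) := by field_simp; ring
  rw [h2] at this
  have h3 : 0 < a ^ 2 / (4 * (|b| + 1) ^ 2) := by positivity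
  have h4 : b - 2 * (|b| + 1) < 0 := by linarith [le_abs_self b, abs_nonneg b]
  linarith [mul_neg_of_pos_of_neg h3 h4]

/-! ### First-order optimality of the oracle -/

section Polar

variable {m r n : ℕ} {A : Matrix (Fin r) (Fin n) ℝ} {S : Matrix (Fin r) (Fin r) ℝ}

theorem posDef_transpose (hS : S.PosDef) : Sᵀ = S := by simpa [IsHermitian] using hS.isHermitian

theorem posDef_isUnit_det (hS : S.PosDef) : IsUnit S.det :=
  (isUnit_iff_isUnit_det S).1 hS.isUnit

theorem polar_mul_transpose (hS : S.PosDef) (h : S * S = A * Aᵀ) :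
    (S⁻¹ * A) * (S⁻¹ * A)ᵀ = 1 := by
  rw [transpose_mul, transpose_nonsing_inv, posDef_transpose hS, Matrix.mul_assoc,
    ← Matrix.mul_assoc A, ← h, Matrix.mul_assoc S, mul_nonsing_inv _ (posDef_isUnit_det hS),
    Matrix.mul_one, nonsing_inv_mul _ (posDef_isUnit_det hS)]

theorem trace_polar (hS : S.PosDef) (h : S * S = A * Aᵀ) : trace ((S⁻¹ * A)ᵀ * A) = trace S := by
  rw [Matrix.trace_mul_comm, transpose_mul, transpose_nonsing_inv, posDef_transpose hS,
    ← Matrix.mul_assoc, ← h, Matrix.mul_assoc, mul_nonsing_inv _ (posDef_isUnit_det hS),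
    Matrix.mul_one]

theorem norm_le_one_of_mul_transpose {Y : Matrix (Fin r) (Fin n) ℝ} (hY : Y * Yᵀ = 1) :
    ‖Y‖ ≤ 1 := by
  rw [← norm_transpose]
  exact norm_le_one_of_orthonormal (by rwa [transpose_transpose])

theorem trace_isometry_mul {V : Matrix (Fin m) (Fin r) ℝ} (hV : Vᵀ * V = 1)
    (Y B : Matrix (Fin r) (Fin n) ℝ) : trace ((V * Y)ᵀ * (V * B)) = trace (Yᵀ * B) := by
  rw [transpose_mul, Matrix.mul_assoc, ← Matrix.mul_assoc Vᵀ, hV, Matrix.one_mul]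

theorem trace_le_nuclearNorm_polar {V : Matrix (Fin m) (Fin r) ℝ} (hV : Vᵀ * V = 1)
    (hS : S.PosDef) (h : S * S = A * Aᵀ) : trace S ≤ nuclearNorm (V * A) := by
  rw [← trace_polar hS h, ← trace_isometry_mul hV]
  exact trace_le_nuclearNorm ((norm_mul_of_orthonormal hV _).trans
    (norm_le_one_of_mul_transpose (polar_mul_transpose hS h))) _

/-- Freezing `S` at its value for `t = 0` leaves a quadratic in `t` that touches the nuclear norm at
`A`. It replaces differentiating the nuclear norm. -/
theorem nuclearNorm_le_tangent {V : Matrix (Fin m) (Fin r) ℝ} (hV : Vᵀ * V = 1)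
    (hS : S.PosDef) (h : S * S = A * Aᵀ) (D : Matrix (Fin r) (Fin n) ℝ) :
    ∃ a : ℝ, ∀ t : ℝ, nuclearNorm (V * (A + t • D)) ≤
      trace S + t * trace ((S⁻¹ * A)ᵀ * D) + t ^ 2 * a := by
  refine ⟨trace (Dᵀ * S⁻¹ * D) / 2, fun t => ?_⟩
  have h1 := two_mul_nuclearNorm_mul_le hV hS (A + t • D)
  have e0 : Aᵀ * S⁻¹ = (S⁻¹ * A)ᵀ := by
    rw [transpose_mul, transpose_nonsing_inv, posDef_transpose hS]
  have e1 : trace (Dᵀ * S⁻¹ * A) = trace ((S⁻¹ * A)ᵀ * D) := by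
    rw [← trace_transpose ((S⁻¹ * A)ᵀ * D), transpose_mul, transpose_transpose, Matrix.mul_assoc]
  have e2 : (A + t • D)ᵀ * S⁻¹ * (A + t • D) = Aᵀ * S⁻¹ * A + t • (Aᵀ * S⁻¹ * D) +
      t • (Dᵀ * S⁻¹ * A) + (t * t) • (Dᵀ * S⁻¹ * D) := by
    simp only [transpose_add, transpose_smul, Matrix.add_mul, Matrix.mul_add, Matrix.smul_mul,
      Matrix.mul_smul, smul_smul, smul_add]
    abel
  rw [e2, trace_add, trace_add, trace_add, trace_smul, trace_smul, trace_smul, e1, e0,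
    trace_polar hS h] at h1
  simp only [smul_eq_mul] at h1
  linarith

theorem nuclearNorm_polar {V : Matrix (Fin m) (Fin r) ℝ} (hV : Vᵀ * V = 1)
    (hS : S.PosDef) (h : S * S = A * Aᵀ) : nuclearNorm (V * A) = trace S := by
  refine le_antisymm ?_ (trace_le_nuclearNorm_polar hV hS h)
  obtain ⟨a, ha⟩ := nuclearNorm_le_tangent hV hS h 0
  simpa using ha 0

/-- At a minimiser, the sum of the two quadratic majorants has vanishing slope in every direction
supported on `I`. Nonzero residual columns on `I` make the column norm smooth there. -/
theorem oracle_first_order {d : ℕ} {V : Matrix (Fin m) (Fin r) ℝ} (hV : Vᵀ * V = 1)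
    (hS : S.PosDef) (h : S * S = A * Aᵀ) {L : Matrix (Fin d) (Fin r) ℝ}
    {X : Matrix (Fin d) (Fin n) ℝ} {lam : ℝ} (hlam : 0 ≤ lam) {I : Finset (Fin n)}
    (hzero : ∀ i ∉ I, (X - L * A).col i = 0) (hne : ∀ i ∈ I, (X - L * A).col i ≠ 0)
    (hmin : ∀ A' : Matrix (Fin r) (Fin n) ℝ, (∀ i ∉ I, A'.col i = A.col i) →
        oracleObjective V L X lam A ≤ oracleObjective V L X lam A') :
    S⁻¹ * A * coordProj I = lam • (Lᵀ * colNormalize (X - L * A)) := by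
  set C := X - L * A with hC
  set Y := S⁻¹ * A with hY
  set H := colNormalize C with hH
  have hHP : H * coordProj I = H := by
    refine ext_of_col fun i => ?_
    by_cases hi : i ∈ I
    · exact col_mul_coordProj_of_mem _ hi
    · rw [col_mul_coordProj_of_notMem _ hi, hH, colNormalize_col, hzero i hi, smul_zero]
  have hvar : ∀ D : Matrix (Fin r) (Fin n) ℝ, (∀ i ∉ I, D.col i = 0) →
      trace (Yᵀ * D) - lam * trace (Hᵀ * (L * D)) = 0 := by
    intro D hD
    obtain ⟨a, ha⟩ := nuclearNorm_le_tangent hV hS h D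
    obtain ⟨b, hb⟩ := norm21_le_tangent C (L * D) (fun i hi => by
      have : i ∉ I := fun hI => hne i hI hi
      rw [col_mul, hD i this, mulVec_zero])
    refine eq_zero_of_forall_mul_add_sq_nonneg (b := a + lam * b) fun t => ?_
    have h1 := hmin (A + t • D) (fun i hi => by
      have : (A + t • D).col i = A.col i + t • D.col i := rfl
      rw [this, hD i hi, smul_zero, add_zero])
    have e : X - L * (A + t • D) = C - t • (L * D) := by
      rw [hC, Matrix.mul_add, Matrix.mul_smul]; abel
    rw [oracleObjective, oracleObjective, e, nuclearNorm_polar hV hS h, ← hC] at h1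
    have h2 := ha t
    have h3 := mul_le_mul_of_nonneg_left (hb t) hlam
    linarith
  clear_value Y
  -- Testing stationarity on its own defect turns it into `trace (Dᵀ D) = 0`.
  set D := (Y - lam • (Lᵀ * H)) * coordProj I with hD
  have h0 := hvar D fun i hi => col_mul_coordProj_of_notMem _ hi
  have h1 : trace (Dᵀ * D) = 0 := by
    have e1 : Dᵀ * D = coordProj I * ((Y - lam • (Lᵀ * H))ᵀ * D) := by
      conv_lhs => rw [hD, transpose_mul, coordProj_transpose, ← hD, Matrix.mul_assoc]
    have e2 : D * coordProj I = D := by rw [hD, Matrix.mul_assoc, coordProj_mul_self]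
    rw [e1, Matrix.trace_mul_comm, Matrix.mul_assoc, e2, transpose_sub, transpose_smul,
      transpose_mul, transpose_transpose, Matrix.sub_mul, trace_sub, Matrix.smul_mul, trace_smul,
      Matrix.mul_assoc, smul_eq_mul]
    exact h0
  have h2 : D = 0 := by
    rw [trace_transpose_mul_self_eq, Finset.sum_eq_zero_iff_of_nonneg
      (fun i _ => sq_nonneg _)] at h1
    refine ext_of_col fun i => ?_
    exact colNorm_eq_zero.1 (pow_eq_zero_iff two_ne_zero |>.1 (h1 i (Finset.mem_univ i)))
  rw [hD, Matrix.sub_mul, Matrix.smul_mul, Matrix.mul_assoc, hHP, sub_eq_zero] at h2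
  exact h2

end Polar

/-! ### Pseudo-inverse and dual certificate -/

theorem one_sub_coordProj {n : ℕ} (I : Finset (Fin n)) : 1 - coordProj I = coordProj Iᶜ := by
  rw [coordProj, coordProj, ← diagonal_one, diagonal_sub]
  congr 1; ext i; by_cases hi : i ∈ I <;> simp [hi]

theorem norm_coordProj_le {n : ℕ} (I : Finset (Fin n)) : ‖coordProj I‖ ≤ 1 := by
  rw [coordProj, l2_opNorm_diagonal, pi_norm_le_iff_of_nonneg zero_le_one]
  intro i; split_ifs <;> simp

theorem norm_one_sub_proj_le {n r : ℕ} {V : Matrix (Fin n) (Fin r) ℝ} (hV : Vᵀ * V = 1) :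
    ‖1 - V * Vᵀ‖ ≤ 1 := by
  refine opNorm_le_of_mulVec zero_le_one fun x => ?_
  rw [one_mul]
  refine le_of_sq_le_sq ?_ (norm_nonneg _)
  have h1 : (V *ᵥ (Vᵀ *ᵥ x)) ⬝ᵥ (V *ᵥ (Vᵀ *ᵥ x)) = (Vᵀ *ᵥ x) ⬝ᵥ (Vᵀ *ᵥ x) := by
    rw [← dotProduct_transpose_mulVec, mulVec_mulVec, hV, one_mulVec]
  have h2 : x ⬝ᵥ (V *ᵥ (Vᵀ *ᵥ x)) = (Vᵀ *ᵥ x) ⬝ᵥ (Vᵀ *ᵥ x) := by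
    rw [← dotProduct_transpose_mulVec]
  have h3 : (V *ᵥ (Vᵀ *ᵥ x)) ⬝ᵥ x = (Vᵀ *ᵥ x) ⬝ᵥ (Vᵀ *ᵥ x) := by rw [dotProduct_comm, h2]
  rw [sub_mulVec, one_mulVec, ← mulVec_mulVec, norm_toLp_sq, norm_toLp_sq, sub_dotProduct,
    dotProduct_sub, dotProduct_sub, h1, h2, h3]
  have : 0 ≤ (Vᵀ *ᵥ x) ⬝ᵥ (Vᵀ *ᵥ x) := by rw [← norm_toLp_sq]; positivity
  linarith

theorem norm_mul_le_of_le {m n k : ℕ} {A : Matrix (Fin m) (Fin n) ℝ} {B : Matrix (Fin n) (Fin k) ℝ}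
    {a b : ℝ} (hA : ‖A‖ ≤ a) (hB : ‖B‖ ≤ b) : ‖A * B‖ ≤ a * b :=
  (l2_opNorm_mul A B).trans
    (mul_le_mul hA hB (norm_nonneg _) ((norm_nonneg _).trans hA))

/-- From `R = 1 + R G`, with `49/40 = 1 / (1 - 9/49)`. -/
theorem exists_inverse_one_sub {r : ℕ} {G : Matrix (Fin r) (Fin r) ℝ} (hG : ‖G‖ ≤ 9 / 49) :
    ∃ R : Matrix (Fin r) (Fin r) ℝ, R * (1 - G) = 1 ∧ ‖R‖ ≤ 49 / 40 := by
  have hu : IsUnit (1 - G) := isUnit_one_sub_of_norm_lt_one (by linarith)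
  obtain ⟨R, hR⟩ := hu.exists_left_inv
  refine ⟨R, hR, ?_⟩
  have e : R = 1 + R * G := by
    rw [Matrix.mul_sub, Matrix.mul_one, sub_eq_iff_eq_add] at hR
    exact hR
  have h1 : ‖(1 : Matrix (Fin r) (Fin r) ℝ)‖ ≤ 1 := norm_le_one_of_orthonormal (by simp)
  have h2 : ‖R‖ ≤ 1 + ‖R‖ * (9 / 49) := by
    conv_lhs => rw [e]
    exact (norm_add_le _ _).trans (add_le_add h1 (norm_mul_le_of_le le_rfl hG))
  linarith

theorem diagonal_inv_mul_diagonal {r : ℕ} {σ : Fin r → ℝ} (hσ : ∀ k, 0 < σ k) :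
    diagonal (fun k => (σ k)⁻¹) * diagonal σ = 1 := by
  rw [diagonal_mul_diagonal, ← diagonal_one]
  congr 1; ext k; exact inv_mul_cancel₀ (hσ k).ne'

theorem diagonal_mul_diagonal_inv {r : ℕ} {σ : Fin r → ℝ} (hσ : ∀ k, 0 < σ k) :
    diagonal σ * diagonal (fun k => (σ k)⁻¹) = 1 := by
  rw [diagonal_mul_diagonal, ← diagonal_one]
  congr 1; ext k; exact mul_inv_cancel₀ (hσ k).ne'

section SVD

variable {d n r : ℕ} {X : Matrix (Fin d) (Fin n) ℝ} {U : Matrix (Fin d) (Fin r) ℝ}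
  {σ : Fin r → ℝ} {V : Matrix (Fin n) (Fin r) ℝ}

theorem IsSVD.transpose_eq (h : IsSVD X U σ V) : Xᵀ = V * (diagonal σ * Uᵀ) := by
  rw [h.eq, transpose_mul, transpose_mul, transpose_transpose, diagonal_transpose]

theorem IsSVD.left_proj_mul (h : IsSVD X U σ V) : U * Uᵀ * X = X := by
  conv_rhs => rw [h.eq]
  rw [h.eq, Matrix.mul_assoc U Uᵀ, Matrix.mul_assoc U (diagonal σ), ← Matrix.mul_assoc Uᵀ U,
    h.left_orthonormal, Matrix.one_mul]

theorem IsSVD.right_proj_mul (h : IsSVD X U σ V) : V * Vᵀ * Xᵀ = Xᵀ := by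
  rw [h.transpose_eq, Matrix.mul_assoc V Vᵀ, ← Matrix.mul_assoc Vᵀ V, h.right_orthonormal,
    Matrix.one_mul]

/-- The transpose of the Moore–Penrose inverse, read off a singular value decomposition. -/
noncomputable def pinvT (U : Matrix (Fin d) (Fin r) ℝ) (σ : Fin r → ℝ)
    (V : Matrix (Fin n) (Fin r) ℝ) : Matrix (Fin d) (Fin n) ℝ :=
  U * (diagonal (fun k => (σ k)⁻¹) * Vᵀ)

theorem IsSVD.pinvT_mul_transpose (h : IsSVD X U σ V) : pinvT U σ V * Xᵀ = U * Uᵀ := by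
  rw [h.transpose_eq, pinvT, Matrix.mul_assoc, Matrix.mul_assoc, ← Matrix.mul_assoc Vᵀ,
    h.right_orthonormal, Matrix.one_mul, ← Matrix.mul_assoc (diagonal _),
    diagonal_inv_mul_diagonal h.pos, Matrix.one_mul]

theorem IsSVD.transpose_mul_pinvT (h : IsSVD X U σ V) : Xᵀ * pinvT U σ V = V * Vᵀ := by
  rw [h.transpose_eq, pinvT, Matrix.mul_assoc, Matrix.mul_assoc, ← Matrix.mul_assoc Uᵀ,
    h.left_orthonormal, Matrix.one_mul, ← Matrix.mul_assoc (diagonal _),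
    diagonal_mul_diagonal_inv h.pos, Matrix.one_mul]

end SVD

/-- The dual certificate: a matrix `Q` such that `XᵀQ` is a strict subgradient of the nuclear norm
at a matrix with polar factor `V₀ Y`, and `Q = lam H` on the columns in `I`. -/
theorem exists_dual_certificate {d n r rX : ℕ} {X : Matrix (Fin d) (Fin n) ℝ}
    {UX : Matrix (Fin d) (Fin rX) ℝ} {σX : Fin rX → ℝ} {VX : Matrix (Fin n) (Fin rX) ℝ}
    (hX : IsSVD X UX σX VX) (hX0 : 0 < ‖X‖) {V₀ : Matrix (Fin n) (Fin r) ℝ} (hV : V₀ᵀ * V₀ = 1)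
    (hrow : VX * VXᵀ * V₀ = V₀) {β : ℝ} (hβ : IsRWD X σX VX V₀ β)
    {Y : Matrix (Fin r) (Fin n) ℝ} (hY : Y * Yᵀ = 1) {H : Matrix (Fin d) (Fin n) ℝ}
    {I : Finset (Fin n)} (hHP : H * coordProj I = H) {K : Matrix (Fin n) (Fin n) ℝ}
    (hHX : H = X * K) {lam : ℝ} (hlam : 0 ≤ lam)
    (hYP : Y * coordProj I = lam • ((X * V₀)ᵀ * H)) (hbd : lam * ‖H‖ * ‖X‖ ≤ 3 / 7) :
    ∃ (Q : Matrix (Fin d) (Fin n) ℝ) (W : Matrix (Fin n) (Fin n) ℝ),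
      Xᵀ * Q = V₀ * Y + W ∧ V₀ᵀ * W = 0 ∧ W * Yᵀ = 0 ∧ ‖W‖ < 1 ∧ Q * coordProj I = lam • H ∧
      ∀ i ∉ I, colNorm Q i ≤ (61 + 21 * β) / (40 * β * ‖X‖) * colNorm Y i := by
  obtain ⟨hβ0, hβ1⟩ := hβ
  set P := coordProj I with hP
  set J := pinvT UX σX VX with hJ
  have hPP : P * P = P := coordProj_mul_self I
  have hPt : Pᵀ = P := coordProj_transpose I
  have hYn : ‖Y‖ ≤ 1 := norm_le_one_of_mul_transpose hY
  have hYtn : ‖Yᵀ‖ ≤ 1 := by rwa [norm_transpose]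
  have hVtn : ‖V₀ᵀ‖ ≤ 1 := by rw [norm_transpose]; exact norm_le_one_of_orthonormal hV
  have hXV : ‖(X * V₀)ᵀ‖ ≤ ‖X‖ := by
    rw [norm_transpose]
    simpa using norm_mul_le_of_le (le_refl ‖X‖) (norm_le_one_of_orthonormal hV)
  have hYPn : ‖Y * P‖ ≤ 3 / 7 := by
    rw [hYP, norm_smul, Real.norm_eq_abs, abs_of_nonneg hlam]
    refine le_trans ?_ hbd
    calc lam * ‖(X * V₀)ᵀ * H‖ ≤ lam * (‖X‖ * ‖H‖) :=
          mul_le_mul_of_nonneg_left (norm_mul_le_of_le hXV le_rfl) hlam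
      _ = lam * ‖H‖ * ‖X‖ := by ring
  set G := Y * P * Yᵀ with hG
  have hGn : ‖G‖ ≤ 9 / 49 := by
    have e : G = (Y * P) * (Y * P)ᵀ := by
      rw [transpose_mul, hPt, ← Matrix.mul_assoc, Matrix.mul_assoc Y P P, hPP]
    rw [e]
    have := norm_mul_le_of_le hYPn (by rw [norm_transpose]; exact hYPn : ‖(Y * P)ᵀ‖ ≤ 3 / 7)
    linarith
  obtain ⟨R, hR, hRn⟩ := exists_inverse_one_sub hGn
  -- `M` is the correction, supported on `I` and orthogonal to `V₀`, that turns `V₀ Y P` into `lam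
  -- XᵀH`.
  obtain ⟨M, hM⟩ : ∃ M, M = lam • ((1 - V₀ * V₀ᵀ) * (Xᵀ * H)) := ⟨_, rfl⟩
  have hM' : M = lam • (Xᵀ * H) - V₀ * (Y * P) := by
    rw [hM, hYP, Matrix.sub_mul, Matrix.one_mul, smul_sub, Matrix.mul_smul, transpose_mul]
    simp only [Matrix.mul_assoc]
  have hMP : M * P = M := by
    rw [hM, Matrix.smul_mul, Matrix.mul_assoc, Matrix.mul_assoc, hHP]
  have hMn : ‖M‖ ≤ 3 / 7 := by
    rw [hM, norm_smul, Real.norm_eq_abs, abs_of_nonneg hlam]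
    refine le_trans ?_ hbd
    have h1 : ‖Xᵀ * H‖ ≤ ‖X‖ * ‖H‖ := norm_mul_le_of_le (norm_transpose X).le le_rfl
    calc lam * ‖(1 - V₀ * V₀ᵀ) * (Xᵀ * H)‖ ≤ lam * (1 * (‖X‖ * ‖H‖)) :=
          mul_le_mul_of_nonneg_left (norm_mul_le_of_le (norm_one_sub_proj_le hV) h1) hlam
      _ = lam * ‖H‖ * ‖X‖ := by ring
  have hVM : V₀ᵀ * M = 0 := by
    have e : V₀ᵀ * (1 - V₀ * V₀ᵀ) = 0 := by
      rw [Matrix.mul_sub, Matrix.mul_one, ← Matrix.mul_assoc, hV, Matrix.one_mul, sub_self]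
    rw [hM, Matrix.mul_smul, ← Matrix.mul_assoc, e, Matrix.zero_mul, smul_zero]
  -- An oblique projection: `N P = 0` and `N Yᵀ = Yᵀ`. Subtracting `M N` from `M` therefore gives `W
  -- Yᵀ = 0` without disturbing the columns in `I`.
  set N := Yᵀ * (R * (Y * (1 - P))) with hN
  have hNP : N * P = 0 := by
    rw [hN]
    simp only [Matrix.mul_assoc, Matrix.sub_mul, hPP, Matrix.one_mul, sub_self, Matrix.mul_zero]
  have hNY : N * Yᵀ = Yᵀ := by
    have e : Y * (1 - P) * Yᵀ = 1 - G := by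
      rw [Matrix.mul_sub, Matrix.mul_one, Matrix.sub_mul, hY]
    rw [hN, Matrix.mul_assoc, Matrix.mul_assoc, e, hR, Matrix.mul_one]
  have hNn : ‖N‖ ≤ 49 / 40 := by
    have h1 : ‖(1 : Matrix (Fin n) (Fin n) ℝ) - P‖ ≤ 1 := by
      rw [hP, one_sub_coordProj]; exact norm_coordProj_le _
    have := norm_mul_le_of_le hYtn (norm_mul_le_of_le hRn (norm_mul_le_of_le hYn h1))
    linarith
  have hJV : ‖J * V₀‖ ≤ 1 / (β * ‖X‖) := by
    rw [hJ, pinvT, Matrix.mul_assoc]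
    exact (norm_mul_of_orthonormal hX.left_orthonormal _).trans hβ1
  -- The columns of `H` lie in the column space of `X`, where `J Xᵀ` acts as the identity.
  have hJXH : J * (Xᵀ * H) = H := by
    rw [← Matrix.mul_assoc, hJ, hX.pinvT_mul_transpose, hHX, ← Matrix.mul_assoc, hX.left_proj_mul]
  have hJM : ‖J * M‖ ≤ 3 / (7 * ‖X‖) * (1 + 1 / β) := by
    have h1 : lam * ‖H‖ ≤ 3 / (7 * ‖X‖) := by
      rw [le_div_iff₀ (by positivity)]; linarith
    have h2 : ‖J * V₀ * (Y * P)‖ ≤ 1 / (β * ‖X‖) * (3 / 7) := norm_mul_le_of_le hJV hYPn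
    rw [hM', Matrix.mul_sub, Matrix.mul_smul, hJXH, ← Matrix.mul_assoc]
    refine (norm_sub_le _ _).trans ?_
    rw [norm_smul, Real.norm_eq_abs, abs_of_nonneg hlam]
    refine (add_le_add h1 h2).trans (le_of_eq ?_)
    field_simp
  refine ⟨J * (V₀ * Y + (M - M * N)), M - M * N, ?_, ?_, ?_, ?_, ?_, ?_⟩
  · have hproj : VX * VXᵀ * M = M := by
      rw [hM', Matrix.mul_sub, Matrix.mul_smul, ← Matrix.mul_assoc, hX.right_proj_mul,
        ← Matrix.mul_assoc, hrow]
    rw [← Matrix.mul_assoc, hJ, hX.transpose_mul_pinvT, Matrix.mul_add, Matrix.mul_sub,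
      ← Matrix.mul_assoc, hrow, ← Matrix.mul_assoc _ M, hproj]
  · rw [Matrix.mul_sub, ← Matrix.mul_assoc, hVM, Matrix.zero_mul, sub_self]
  · rw [Matrix.sub_mul, Matrix.mul_assoc, hNY, sub_self]
  -- The bound is `3/7 · (1 + 49/40) = 267/280`.
  · have h1 := norm_mul_le_of_le hMn hNn
    have h2 := norm_sub_le M (M * N)
    linarith
  · rw [Matrix.mul_assoc, Matrix.add_mul, Matrix.sub_mul, hMP, Matrix.mul_assoc M, hNP,
      Matrix.mul_zero, sub_zero, Matrix.mul_assoc]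
    rw [hM', add_sub_cancel, Matrix.mul_smul, hJXH]
  -- Outside `I` the column of `M` vanishes, so both remaining terms are matrices applied to the
  -- column of `Y`.
  · intro i hi
    have hMi : M.col i = 0 := by
      rw [← hMP]; exact col_mul_coordProj_of_notMem _ hi
    have hYi : (Y * (1 - P)).col i = Y.col i := by
      rw [hP, one_sub_coordProj]; exact col_mul_coordProj_of_mem _ (by simpa using hi)
    have hcol : (J * (V₀ * Y + (M - M * N))).col i =
        (J * V₀) *ᵥ Y.col i - (J * M * Yᵀ * R) *ᵥ Y.col i := by
      have e : (V₀ * Y + (M - M * N)).col i =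
          (V₀ * Y).col i + (M.col i - (M * N).col i) := rfl
      rw [col_mul, e, hMi, zero_sub, mulVec_add, mulVec_neg, ← sub_eq_add_neg, col_mul, col_mul, hN,
        ← Matrix.mul_assoc, col_mul, hYi]
      simp only [mulVec_mulVec, Matrix.mul_assoc]
    have h1 : ‖J * M * Yᵀ * R‖ ≤ 3 / (7 * ‖X‖) * (1 + 1 / β) * 1 * (49 / 40) :=
      norm_mul_le_of_le (norm_mul_le_of_le hJM hYtn) hRn
    have h2 := (norm_mulVec_le (J * V₀) (Y.col i)).trans
      (mul_le_mul_of_nonneg_right hJV (norm_nonneg _))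
    have h3 := (norm_mulVec_le (J * M * Yᵀ * R) (Y.col i)).trans
      (mul_le_mul_of_nonneg_right h1 (norm_nonneg _))
    rw [colNorm, hcol, toLp_sub]
    refine (norm_sub_le _ _).trans ((add_le_add h2 h3).trans (le_of_eq ?_))
    rw [colNorm]
    field_simp
    ring

theorem norm_le_sqrt_sum_colNorm_sq {m n : ℕ} (M : Matrix (Fin m) (Fin n) ℝ) :
    ‖M‖ ≤ √(∑ i, colNorm M i ^ 2) := by
  refine opNorm_le_of_mulVec (Real.sqrt_nonneg _) fun x => ?_
  have e : toLp 2 (M *ᵥ x) = ∑ i, x i • toLp 2 (M.col i) := by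
    rw [mulVec_eq_sum]
    ext j; simp [mul_comm]
  have h1 : ‖toLp 2 (M *ᵥ x)‖ ≤ ∑ i, colNorm M i * |x i| := by
    rw [e]
    refine (norm_sum_le _ _).trans (Finset.sum_le_sum fun i _ => ?_)
    rw [norm_smul, Real.norm_eq_abs, mul_comm, colNorm]
  refine h1.trans ?_
  rw [EuclideanSpace.norm_eq]
  refine (Real.sum_mul_le_sqrt_mul_sqrt _ _ _).trans (le_of_eq ?_)
  simp

/-! ### Equality cases in the duality inequalities -/

section StrictSubgradient

variable {n r : ℕ} {V : Matrix (Fin n) (Fin r) ℝ} {Y : Matrix (Fin r) (Fin n) ℝ}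
  {W : Matrix (Fin n) (Fin n) ℝ}

theorem norm_sq_subgradient_mulVec (hV : Vᵀ * V = 1) (hVW : Vᵀ * W = 0) (x : Fin n → ℝ) :
    ‖toLp 2 ((V * Y + W) *ᵥ x)‖ ^ 2 = ‖toLp 2 (Y *ᵥ x)‖ ^ 2 + ‖toLp 2 (W *ᵥ x)‖ ^ 2 := by
  have h1 : (V *ᵥ (Y *ᵥ x)) ⬝ᵥ (W *ᵥ x) = 0 := by
    rw [dotProduct_comm, ← dotProduct_transpose_mulVec, mulVec_mulVec, hVW, zero_mulVec,
      zero_dotProduct]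
  rw [add_mulVec, ← mulVec_mulVec, norm_toLp_sq, add_dotProduct, dotProduct_add, dotProduct_add,
    dotProduct_comm (W *ᵥ x), h1, ← norm_toLp_sq, ← norm_toLp_sq, norm_mulVec_of_orthonormal hV]
  ring

theorem norm_sq_mulVec_complement_le (hY : Y * Yᵀ = 1) (hWY : W * Yᵀ = 0) (x : Fin n → ℝ) :
    ‖toLp 2 (W *ᵥ x)‖ ^ 2 ≤ ‖W‖ ^ 2 * (‖toLp 2 x‖ ^ 2 - ‖toLp 2 (Y *ᵥ x)‖ ^ 2) := by
  have e1 : W *ᵥ x = W *ᵥ (x - Yᵀ *ᵥ (Y *ᵥ x)) := by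
    rw [mulVec_sub, mulVec_mulVec, hWY, zero_mulVec, sub_zero]
  have h0 : (Yᵀ *ᵥ (Y *ᵥ x)) ⬝ᵥ x = (Y *ᵥ x) ⬝ᵥ (Y *ᵥ x) := dotProduct_transpose_mulVec _ _ _
  have h1 : x ⬝ᵥ (Yᵀ *ᵥ (Y *ᵥ x)) = (Y *ᵥ x) ⬝ᵥ (Y *ᵥ x) := by rw [dotProduct_comm, h0]
  have h2 : (Yᵀ *ᵥ (Y *ᵥ x)) ⬝ᵥ (Yᵀ *ᵥ (Y *ᵥ x)) = (Y *ᵥ x) ⬝ᵥ (Y *ᵥ x) := by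
    rw [dotProduct_transpose_mulVec, mulVec_mulVec, hY, one_mulVec]
  have e2 : ‖toLp 2 (x - Yᵀ *ᵥ (Y *ᵥ x))‖ ^ 2 = ‖toLp 2 x‖ ^ 2 - ‖toLp 2 (Y *ᵥ x)‖ ^ 2 := by
    rw [norm_toLp_sq, norm_toLp_sq, norm_toLp_sq, sub_dotProduct, dotProduct_sub, dotProduct_sub,
      h0, h1, h2]
    ring
  rw [e1, ← e2, ← mul_pow]
  exact pow_le_pow_left₀ (norm_nonneg _) (norm_mulVec_le _ _) 2

theorem norm_subgradient_le (hV : Vᵀ * V = 1) (hY : Y * Yᵀ = 1) (hVW : Vᵀ * W = 0)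
    (hWY : W * Yᵀ = 0) (hW : ‖W‖ < 1) : ‖V * Y + W‖ ≤ 1 := by
  refine opNorm_le_of_mulVec zero_le_one fun x => ?_
  rw [one_mul]
  refine le_of_sq_le_sq ?_ (norm_nonneg _)
  rw [norm_sq_subgradient_mulVec hV hVW]
  have h1 := norm_sq_mulVec_complement_le hY hWY x
  have h2 : ‖toLp 2 (Y *ᵥ x)‖ ^ 2 ≤ ‖toLp 2 x‖ ^ 2 := by
    refine pow_le_pow_left₀ (norm_nonneg _) ((norm_mulVec_le _ _).trans ?_) 2
    exact mul_le_of_le_one_left (norm_nonneg _) (norm_le_one_of_mul_transpose hY)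
  have h3 : ‖W‖ ^ 2 ≤ 1 := pow_le_one₀ (norm_nonneg _) hW.le
  nlinarith

/-- Equality must hold at each right singular vector `x` of `Z`. If `Z x ≠ 0`, then `(V Y + W) x` is
the unit vector along `Z x`. Since `‖W‖ < 1`, unit length is possible only if `W x = 0`, so `Z x`
lies in the range of `V`. -/
theorem proj_mul_eq_of_nuclearNorm_le (hV : Vᵀ * V = 1) (hY : Y * Yᵀ = 1) (hVW : Vᵀ * W = 0)
    (hWY : W * Yᵀ = 0) (hW : ‖W‖ < 1) {Z : Matrix (Fin n) (Fin n) ℝ}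
    (hZ : nuclearNorm Z ≤ trace ((V * Y + W)ᵀ * Z)) : V * Vᵀ * Z = Z := by
  obtain ⟨b, hb, -⟩ := exists_nuclear_basis Z
  set D := V * Y + W with hD
  have hDn : ‖D‖ ≤ 1 := norm_subgradient_le hV hY hVW hWY hW
  have hterm : ∀ k, (D *ᵥ ofLp (b k)) ⬝ᵥ (Z *ᵥ ofLp (b k)) ≤ ‖toLp 2 (Z *ᵥ ofLp (b k))‖ :=
    fun k => (dotProduct_le_norm_mul_norm _ _).trans
      (mul_le_of_le_one_left (norm_nonneg _) (norm_mulVec_basis_le hDn b k))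
  have heq : ∀ k, (D *ᵥ ofLp (b k)) ⬝ᵥ (Z *ᵥ ofLp (b k)) = ‖toLp 2 (Z *ᵥ ofLp (b k))‖ := by
    have h1 := Finset.sum_le_sum fun k (_ : k ∈ Finset.univ) => hterm k
    rw [hb, trace_transpose_mul_eq_sum D Z b] at hZ
    have h2 := (Finset.sum_eq_sum_iff_of_le fun k (_ : k ∈ Finset.univ) => hterm k).1
      (le_antisymm h1 hZ)
    exact fun k => h2 k (Finset.mem_univ k)
  have hkey : ∀ k, (V * Vᵀ * Z) *ᵥ ofLp (b k) = Z *ᵥ ofLp (b k) := by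
    intro k
    have hk := heq k
    have hDb := norm_mulVec_basis_le hDn b k
    have hbn := norm_basis b k
    rw [← mulVec_mulVec]
    generalize Z *ᵥ ofLp (b k) = z at hk ⊢
    generalize ofLp (b k) = x at hk hDb hbn
    by_cases hz : z = 0
    · rw [hz, mulVec_zero]
    have hzpos : 0 < ‖toLp 2 z‖ := by simpa using hz
    have hDx : ‖toLp 2 (D *ᵥ x)‖ = 1 := by
      refine le_antisymm hDb ?_
      have := dotProduct_le_norm_mul_norm (D *ᵥ x) z
      rw [hk] at this
      exact le_of_mul_le_mul_right (by rwa [one_mul]) hzpos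
    have hk' : z ⬝ᵥ (D *ᵥ x) = ‖toLp 2 z‖ := by rw [dotProduct_comm, hk]
    have hzD : z = ‖toLp 2 z‖ • (D *ᵥ x) := by
      have h0 : ‖toLp 2 (z - ‖toLp 2 z‖ • (D *ᵥ x))‖ ^ 2 = 0 := by
        rw [norm_toLp_sq, sub_dotProduct, dotProduct_sub, dotProduct_sub, smul_dotProduct,
          smul_dotProduct, dotProduct_smul, dotProduct_smul, hk', hk,
          ← norm_toLp_sq, ← norm_toLp_sq, hDx]
        simp only [smul_eq_mul]
        ring
      rw [pow_eq_zero_iff two_ne_zero, norm_eq_zero] at h0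
      exact sub_eq_zero.1 ((toLp_eq_zero 2).1 h0)
    have h1 := norm_sq_subgradient_mulVec (Y := Y) hV hVW x
    have h2 := norm_sq_mulVec_complement_le hY hWY x
    rw [← hD, hDx] at h1
    rw [hbn] at h2
    have h3 : ‖W‖ ^ 2 < 1 := pow_lt_one₀ (norm_nonneg _) hW two_ne_zero
    have h4 : ‖toLp 2 (W *ᵥ x)‖ ^ 2 = 0 := by
      have := sq_nonneg ‖toLp 2 (W *ᵥ x)‖
      nlinarith
    have hWx : W *ᵥ x = 0 := by simpa using h4
    have hDV : D *ᵥ x = V *ᵥ (Y *ᵥ x) := by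
      rw [hD, add_mulVec, hWx, add_zero, mulVec_mulVec]
    rw [hzD, mulVec_smul, hDV, mulVec_mulVec, Matrix.mul_assoc, hV, Matrix.mul_one]
  apply toEuclideanLin.injective
  refine b.toBasis.ext fun k => ?_
  rw [b.coe_toBasis, ← mulVec_eq_toEuclideanLin, ← mulVec_eq_toEuclideanLin, hkey]

end StrictSubgradient

theorem trace_le_of_colNorm_le {m n : ℕ} {Q C : Matrix (Fin m) (Fin n) ℝ} {lam : ℝ}
    (hQ : ∀ i, colNorm Q i ≤ lam) : trace (Qᵀ * C) ≤ lam * norm21 C := by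
  rw [trace_transpose_mul_eq_sum_col, norm21, Finset.mul_sum]
  exact Finset.sum_le_sum fun i _ => (dotProduct_le_norm_mul_norm _ _).trans
    (mul_le_mul_of_nonneg_right (hQ i) (colNorm_nonneg C i))

theorem col_eq_zero_of_norm21_le {m n : ℕ} {Q C : Matrix (Fin m) (Fin n) ℝ} {lam : ℝ}
    {I : Finset (Fin n)} (hQ : ∀ i, colNorm Q i ≤ lam) (hQ' : ∀ i ∉ I, colNorm Q i < lam)
    (h : lam * norm21 C ≤ trace (Qᵀ * C)) : ∀ i ∉ I, C.col i = 0 := by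
  have hterm : ∀ i, Q.col i ⬝ᵥ C.col i ≤ colNorm Q i * colNorm C i := fun i =>
    dotProduct_le_norm_mul_norm _ _
  have hterm' : ∀ i ∈ Finset.univ, Q.col i ⬝ᵥ C.col i ≤ lam * colNorm C i := fun i _ =>
    (hterm i).trans (mul_le_mul_of_nonneg_right (hQ i) (colNorm_nonneg C i))
  have h1 := Finset.sum_le_sum hterm'
  rw [trace_transpose_mul_eq_sum_col, norm21, Finset.mul_sum] at h
  intro i hi
  have h2 := (Finset.sum_eq_sum_iff_of_le hterm').1 (le_antisymm h1 h) i (Finset.mem_univ i)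
  by_contra hne
  have hpos : 0 < colNorm C i :=
    lt_of_le_of_ne (colNorm_nonneg C i) fun h0 => hne (colNorm_eq_zero.1 h0.symm)
  have h3 := mul_lt_mul_of_pos_right (hQ' i hi) hpos
  linarith [hterm i]

/-! ### Row spaces, supports and recovery -/

theorem mem_colSupport {m n : ℕ} {M : Matrix (Fin m) (Fin n) ℝ} {i : Fin n} :
    i ∈ colSupport M ↔ M.col i ≠ 0 := by
  simp [colSupport]

section SVD

variable {d n r rX : ℕ} {X : Matrix (Fin d) (Fin n) ℝ} {U : Matrix (Fin d) (Fin r) ℝ}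
  {σ : Fin r → ℝ} {V : Matrix (Fin n) (Fin r) ℝ}

theorem IsSVD.right_transpose_eq (h : IsSVD X U σ V) :
    Vᵀ = diagonal (fun k => (σ k)⁻¹) * Uᵀ * X := by
  conv_rhs => rw [h.eq]
  rw [Matrix.mul_assoc, ← Matrix.mul_assoc Uᵀ, ← Matrix.mul_assoc Uᵀ, h.left_orthonormal,
    Matrix.one_mul, ← Matrix.mul_assoc, diagonal_inv_mul_diagonal h.pos, Matrix.one_mul]

theorem IsSVD.left_eq (h : IsSVD X U σ V) :
    U = X * (V * diagonal (fun k => (σ k)⁻¹)) := by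
  conv_rhs => rw [h.eq]
  rw [Matrix.mul_assoc, ← Matrix.mul_assoc Vᵀ, h.right_orthonormal, Matrix.one_mul,
    Matrix.mul_assoc, diagonal_mul_diagonal_inv h.pos, Matrix.mul_one]

theorem IsSVD.mul_right_proj (h : IsSVD X U σ V) : X * V * Vᵀ = X := by
  have := congrArg transpose h.right_proj_mul
  simpa [transpose_mul, Matrix.mul_assoc] using this

theorem IsSVD.transpose_mulVec_eq_zero (h : IsSVD X U σ V) {V₀ : Matrix (Fin n) (Fin rX) ℝ}
    (hrow : V * Vᵀ * V₀ = V₀) {z : Fin n → ℝ} (hz : X *ᵥ z = 0) : V₀ᵀ *ᵥ z = 0 := by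
  have h1 : Vᵀ *ᵥ z = 0 := by rw [h.right_transpose_eq, ← mulVec_mulVec, hz, mulVec_zero]
  rw [← hrow, transpose_mul, transpose_mul, transpose_transpose, ← mulVec_mulVec,
    ← mulVec_mulVec, h1, mulVec_zero, mulVec_zero]

/-- If the columns of `Z` lie in a subspace of the row space and contain its projector up to a
right factor, then the left singular vectors of `Z` span that subspace. -/
theorem IsSVD.left_proj_eq {Z : Matrix (Fin n) (Fin n) ℝ} {U : Matrix (Fin n) (Fin r) ℝ}
    (h : IsSVD Z U σ V) {V₀ : Matrix (Fin n) (Fin rX) ℝ} (hZ : V₀ * V₀ᵀ * Z = Z)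
    {E : Matrix (Fin n) (Fin n) ℝ} (hE : V₀ * V₀ᵀ = Z * E) : U * Uᵀ = V₀ * V₀ᵀ := by
  have h1 : U * Uᵀ * (V₀ * V₀ᵀ) = V₀ * V₀ᵀ := by
    rw [hE, ← Matrix.mul_assoc, h.left_proj_mul]
  have h2 : V₀ * V₀ᵀ * U = U := by
    rw [h.left_eq, ← Matrix.mul_assoc, hZ]
  have h3 := congrArg transpose h1
  rw [transpose_mul, transpose_mul, transpose_mul, transpose_transpose, transpose_transpose,
    ← Matrix.mul_assoc, h2] at h3
  exact h3

end SVD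

theorem col_sub {m n : ℕ} (A B : Matrix (Fin m) (Fin n) ℝ) (i : Fin n) :
    (A - B).col i = A.col i - B.col i := rfl

theorem col_add {m n : ℕ} (A B : Matrix (Fin m) (Fin n) ℝ) (i : Fin n) :
    (A + B).col i = A.col i + B.col i := rfl

theorem col_eq_mulVec_single {m n : ℕ} (A : Matrix (Fin m) (Fin n) ℝ) (i : Fin n) :
    A.col i = A *ᵥ Pi.single i 1 := by simp

/-- The incoherence bound and the choice of the weight make the certificate strictly feasible. -/
theorem certificate_bound_lt {β x s a : ℝ} (hβ : 0 < β) (hx : 0 < x)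
    (hs : 0 < s) (has : a ^ 2 * s ^ 2 ≤ 324 * β ^ 2 / (49 * (11 + 4 * β) ^ 2)) :
    (61 + 21 * β) / (40 * β * x) * a < 3 / (7 * x * s) := by
  have h1 : a * s ≤ 18 * β / (7 * (11 + 4 * β)) := by
    refine le_of_sq_le_sq ?_ (by positivity)
    rw [mul_pow]
    refine has.trans (le_of_eq ?_)
    rw [div_pow]
    congr 1 <;> ring
  have h2 : (61 + 21 * β) / (40 * β * x) * a =
      (61 + 21 * β) / (40 * β * x * s) * (a * s) := by field_simp
  rw [h2]
  refine lt_of_le_of_lt (mul_le_mul_of_nonneg_left h1 (by positivity)) ?_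
  have h3 : (61 + 21 * β) / (40 * β * x * s) * (18 * β / (7 * (11 + 4 * β))) =
      (18 * (61 + 21 * β)) / (40 * (11 + 4 * β)) / (7 * x * s) := by field_simp
  rw [h3]
  refine div_lt_div_of_pos_right ?_ (by positivity)
  rw [div_lt_iff₀ (by positivity)]
  -- Coefficientwise: `18 · 61 < 120 · 11` and `18 · 21 < 120 · 4`.
  linarith

theorem pos_and_lt_one_of_div_one_sub_pos {a : ℝ} (h : 0 < a / (1 - a)) : 0 < a ∧ a < 1 := by
  rcases div_pos_iff.1 h with ⟨h1, h2⟩ | ⟨h1, h2⟩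
  · exact ⟨h1, by linarith⟩
  · linarith

/-- Recovery of the row space and of the column support by any optimal solution, in terms of
numerical bounds on the weight. -/
theorem recovery_of_bounds {d n r rX : ℕ} {X X₀ C₀ : Matrix (Fin d) (Fin n) ℝ}
    {V₀ : Matrix (Fin n) (Fin r) ℝ}
    {UX : Matrix (Fin d) (Fin rX) ℝ} {σX : Fin rX → ℝ} {VX : Matrix (Fin n) (Fin rX) ℝ}
    {β lam : ℝ} (hX : X = X₀ + C₀) (hX₀ : X₀ * V₀ * V₀ᵀ = X₀) (hV : V₀ᵀ * V₀ = 1)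
    (hVP : V₀ᵀ * coordProj (colSupport C₀) = 0) (hXsvd : IsSVD X UX σX VX)
    (hXpos : 0 < ‖X‖) (hβ : IsRWD X σX VX V₀ β) (hrow : VX * VXᵀ * V₀ = V₀) (hlam : 0 < lam)
    (hbd : lam * √((colSupport C₀).card) * ‖X‖ ≤ 3 / 7)
    (hinc : ∀ i, (61 + 21 * β) / (40 * β * ‖X‖) * colNorm V₀ᵀ i < lam)
    {Z : Matrix (Fin n) (Fin n) ℝ} {C : Matrix (Fin d) (Fin n) ℝ} (hopt : IsOptimal X lam Z C) :
    V₀ * V₀ᵀ * Z = Z ∧ V₀ * V₀ᵀ = Z * (1 - coordProj (colSupport C₀)) ∧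
      colSupport C = colSupport C₀ := by
  set I := colSupport C₀ with hI
  have hVI : ∀ i ∈ I, V₀ᵀ.col i = 0 := fun i hi => by
    rw [← col_mul_coordProj_of_mem V₀ᵀ hi, hVP]; rfl
  have hC₀ : ∀ i ∉ I, C₀.col i = 0 := fun i hi => by
    by_contra h; exact hi (mem_colSupport.2 h)
  have hC₀V : C₀ * V₀ = 0 := by
    have e : C₀ * coordProj I = C₀ := by
      refine ext_of_col fun i => ?_
      by_cases hi : i ∈ I
      · exact col_mul_coordProj_of_mem _ hi
      · rw [col_mul_coordProj_of_notMem _ hi, hC₀ i hi]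
    have h := congrArg transpose hVP
    rw [transpose_mul, coordProj_transpose, transpose_transpose, transpose_zero] at h
    rw [← e, Matrix.mul_assoc, h, Matrix.mul_zero]
  have hXV : X * V₀ = X₀ * V₀ := by rw [hX, Matrix.add_mul, hC₀V, add_zero]
  have hXP : X * V₀ * V₀ᵀ = X₀ := by rw [hXV, hX₀]
  have hcoord : ∀ (T : Matrix (Fin n) (Fin n) ℝ) (i : Fin n), (X - X * T).col i = 0 →
      V₀ᵀ.col i = (V₀ᵀ * T).col i := by
    intro T i hi
    have h1 : X *ᵥ (Pi.single i 1 - T.col i) = 0 := by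
      rw [mulVec_sub, ← col_eq_mulVec_single, ← col_mul, ← col_sub, hi]
    have h2 := hXsvd.transpose_mulVec_eq_zero hrow h1
    rw [mulVec_sub, ← col_eq_mulVec_single, sub_eq_zero] at h2
    exact h2
  -- If `X - X T` vanished at an outlier `i`, then `V₀ᵀ T` would too, hence `T` and so `X` itself.
  -- But there `X` equals the nonzero column of `C₀`.
  have hne : ∀ T : Matrix (Fin n) (Fin n) ℝ, V₀ * V₀ᵀ * T = T → ∀ i ∈ I,
      (X - X * T).col i ≠ 0 := by
    intro T hT i hi h0
    have h1 := hcoord T i h0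
    rw [hVI i hi] at h1
    have h2 : T.col i = 0 := by
      rw [← hT, Matrix.mul_assoc, col_mul, ← h1, mulVec_zero]
    have h3 : X₀.col i = 0 := by rw [← hX₀, col_mul, hVI i hi, mulVec_zero]
    rw [col_sub, col_mul, h2, mulVec_zero, sub_zero, hX, col_add, h3, zero_add] at h0
    exact mem_colSupport.1 hi h0
  obtain ⟨A, hAcol, hAmin⟩ := exists_oracle_minimizer hV (X * V₀) X hlam.le I V₀ᵀ
  set Ch := X - X * V₀ * A with hCh
  -- `A` differs from `V₀ᵀ` only on `I`, where the rows of `V₀` vanish.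
  have hAV : A * V₀ = 1 := by
    have h1 : (A - V₀ᵀ) * coordProj I = A - V₀ᵀ := by
      refine ext_of_col fun i => ?_
      by_cases hi : i ∈ I
      · exact col_mul_coordProj_of_mem _ hi
      · rw [col_mul_coordProj_of_notMem _ hi, col_sub, hAcol i hi, sub_self]
    have h := congrArg transpose hVP
    rw [transpose_mul, coordProj_transpose, transpose_transpose, transpose_zero] at h
    have h2 : (A - V₀ᵀ) * V₀ = 0 := by rw [← h1, Matrix.mul_assoc, h, Matrix.mul_zero]
    rw [Matrix.sub_mul, hV, sub_eq_zero] at h2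
    exact h2
  have hAle : ∀ x, ‖toLp 2 x‖ ≤ ‖toLp 2 (Aᵀ *ᵥ x)‖ := by
    intro x
    have h1 : x = V₀ᵀ *ᵥ (Aᵀ *ᵥ x) := by
      rw [mulVec_mulVec, ← transpose_mul, hAV, transpose_one, one_mulVec]
    conv_lhs => rw [h1]
    exact norm_transpose_mulVec_le (norm_le_one_of_orthonormal hV) _
  obtain ⟨S, hS, hSS, hSinv⟩ := exists_polar A hAle
  have hzero : ∀ i ∉ I, Ch.col i = 0 := by
    intro i hi
    rw [hCh, col_sub, col_mul, hAcol i hi, ← col_mul, hXP, ← col_sub, hX, add_sub_cancel_left]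
    exact hC₀ i hi
  have hne' : ∀ i ∈ I, Ch.col i ≠ 0 := by
    intro i hi
    have := hne (V₀ * A) (by
      rw [Matrix.mul_assoc, ← Matrix.mul_assoc V₀ᵀ, hV, Matrix.one_mul]) i hi
    rwa [← Matrix.mul_assoc] at this
  have hfo := oracle_first_order hV hS hSS hlam.le hzero hne'
    (fun A' hA' => hAmin A' fun i hi => (hA' i hi).trans (hAcol i hi))
  rw [← hCh] at hfo
  obtain ⟨Y, hYdef⟩ : ∃ Y, Y = S⁻¹ * A := ⟨_, rfl⟩
  have hYY : Y * Yᵀ = 1 := by rw [hYdef]; exact polar_mul_transpose hS hSS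
  have hYcol : ∀ i ∉ I, colNorm Y i ≤ colNorm V₀ᵀ i := by
    intro i hi
    have : Y.col i = S⁻¹ *ᵥ V₀ᵀ.col i := by rw [hYdef, col_mul, hAcol i hi]
    rw [colNorm, this]
    exact hSinv _
  obtain ⟨H, hH⟩ : ∃ H, H = colNormalize Ch := ⟨_, rfl⟩
  have hHcol : ∀ i ∉ I, H.col i = 0 := fun i hi => by
    rw [hH, colNormalize_col, hzero i hi, smul_zero]
  have hHP : H * coordProj I = H := by
    refine ext_of_col fun i => ?_
    by_cases hi : i ∈ I
    · exact col_mul_coordProj_of_mem _ hi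
    · rw [col_mul_coordProj_of_notMem _ hi, hHcol i hi]
  have hHX : H = X * ((1 - V₀ * A) * diagonal fun i => (colNorm Ch i)⁻¹) := by
    rw [hH, colNormalize, ← Matrix.mul_assoc X, Matrix.mul_sub, Matrix.mul_one, ← Matrix.mul_assoc]
  have hHle : ∀ i, colNorm H i ≤ 1 := fun i => by rw [hH]; exact colNorm_colNormalize_le _ i
  have hHn : ‖H‖ ≤ √(I.card) := by
    refine (norm_le_sqrt_sum_colNorm_sq H).trans (Real.sqrt_le_sqrt ?_)
    have h1 : ∀ i ∈ Finset.univ, colNorm H i ^ 2 ≤ if i ∈ I then 1 else 0 := by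
      intro i _
      split_ifs with hi
      · exact pow_le_one₀ (colNorm_nonneg _ _) (hHle i)
      · rw [colNorm_eq_zero.2 (hHcol i hi)]; simp
    refine (Finset.sum_le_sum h1).trans (le_of_eq ?_)
    simp
  have hbd' : lam * ‖H‖ * ‖X‖ ≤ 3 / 7 :=
    (mul_le_mul_of_nonneg_right (mul_le_mul_of_nonneg_left hHn hlam.le) hXpos.le).trans hbd
  obtain ⟨Q, W, hXQ, hVW, hWY, hW, hQP, hQcol⟩ := exists_dual_certificate hXsvd hXpos hV hrow hβ
    hYY hHP hHX hlam.le (by rw [hYdef, hH]; exact hfo) hbd'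
  have hQlt : ∀ i ∉ I, colNorm Q i < lam := fun i hi =>
    ((hQcol i hi).trans (mul_le_mul_of_nonneg_left (hYcol i hi)
      (by have := hβ.1; positivity))).trans_lt (hinc i)
  have hQle : ∀ i, colNorm Q i ≤ lam := by
    intro i
    by_cases hi : i ∈ I
    · have h1 : Q.col i = lam • H.col i := by
        rw [← col_mul_coordProj_of_mem Q hi, hQP]; rfl
      rw [colNorm, h1, toLp_smul, norm_smul, Real.norm_eq_abs, abs_of_pos hlam]
      exact mul_le_of_le_one_right hlam.le (hHle i)
    · exact (hQlt i hi).le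
  -- Weak duality: `trace (Qᵀ X)` splits along any feasible pair into the two pairings bounded by
  -- the two norms.
  have hsplit : ∀ (T : Matrix (Fin n) (Fin n) ℝ) (E : Matrix (Fin d) (Fin n) ℝ), X = X * T + E →
      trace (Qᵀ * X) = trace ((V₀ * Y + W)ᵀ * T) + trace (Qᵀ * E) := by
    intro T E h
    conv_lhs => rw [h]
    rw [Matrix.mul_add, trace_add, ← hXQ, transpose_mul, transpose_transpose, Matrix.mul_assoc]
  -- The oracle attains the dual value, so no optimal pair can exceed it.
  have hor : trace (Qᵀ * X) = nuclearNorm (V₀ * A) + lam * norm21 Ch := by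
    rw [hsplit (V₀ * A) Ch (by rw [hCh, ← Matrix.mul_assoc]; abel)]
    have hWV : Wᵀ * V₀ = 0 := by
      have := congrArg transpose hVW
      rwa [transpose_mul, transpose_transpose, transpose_zero] at this
    have h1 : trace ((V₀ * Y + W)ᵀ * (V₀ * A)) = nuclearNorm (V₀ * A) := by
      rw [transpose_add, Matrix.add_mul, trace_add, trace_isometry_mul hV, ← Matrix.mul_assoc Wᵀ,
        hWV, Matrix.zero_mul, trace_zero, add_zero, hYdef, trace_polar hS hSS,
        nuclearNorm_polar hV hS hSS]
    have h2 : trace (Qᵀ * Ch) = lam * norm21 Ch := by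
      have e : Ch * coordProj I = Ch := by
        refine ext_of_col fun i => ?_
        by_cases hi : i ∈ I
        · exact col_mul_coordProj_of_mem _ hi
        · rw [col_mul_coordProj_of_notMem _ hi, hzero i hi]
      have e2 : trace (Qᵀ * Ch) = trace ((Q * coordProj I)ᵀ * Ch) := by
        conv_lhs => rw [← e]
        rw [transpose_mul, coordProj_transpose, ← Matrix.mul_assoc, Matrix.trace_mul_comm,
          ← Matrix.mul_assoc]
      rw [e2, hQP, transpose_smul, Matrix.smul_mul, trace_smul, hH, trace_colNormalize_mul,
        smul_eq_mul]
    rw [h1, h2]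
  obtain ⟨hfeas, hle⟩ := hopt
  have hZC := hle (V₀ * A) Ch (by rw [hCh, ← Matrix.mul_assoc]; abel)
  rw [← hor, hsplit Z C hfeas] at hZC
  have hZ1 := trace_le_nuclearNorm (norm_subgradient_le hV hYY hVW hWY hW) Z
  have hC1 := trace_le_of_colNorm_le (C := C) hQle
  have hPZ : V₀ * V₀ᵀ * Z = Z :=
    proj_mul_eq_of_nuclearNorm_le hV hYY hVW hWY hW (by linarith)
  have hCz : ∀ i ∉ I, C.col i = 0 := col_eq_zero_of_norm21_le hQle hQlt (by linarith)
  have hCeq : C = X - X * Z := eq_sub_of_add_eq' hfeas.symm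
  refine ⟨hPZ, ?_, ?_⟩
  -- Outside `I` the residual is zero, so `V₀ᵀ` and `V₀ᵀ Z` share that column; on `I` both sides
  -- vanish.
  · have h1 : V₀ᵀ = V₀ᵀ * Z * (1 - coordProj I) := by
      refine ext_of_col fun i => ?_
      rw [one_sub_coordProj]
      by_cases hi : i ∈ I
      · rw [col_mul_coordProj_of_notMem _ (by simpa using hi), hVI i hi]
      · rw [col_mul_coordProj_of_mem _ (by simpa using hi)]
        exact hcoord Z i (by rw [← hCeq]; exact hCz i hi)
    conv_lhs => rw [h1]
    rw [← Matrix.mul_assoc, ← Matrix.mul_assoc, hPZ]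
  · ext i
    rw [mem_colSupport]
    refine ⟨fun h => by_contra fun hi => h (hCz i hi), fun hi => ?_⟩
    rw [hCeq]
    exact hne Z hPZ i hi

end LRR

/-! ### From the outlier fraction to the numerical bounds -/

theorem theorem1 {d n r₀ rX : ℕ} (X X₀ C₀ : Matrix (Fin d) (Fin n) ℝ)
    (U₀ : Matrix (Fin d) (Fin r₀) ℝ) (σ₀ : Fin r₀ → ℝ) (V₀ : Matrix (Fin n) (Fin r₀) ℝ)
    (UX : Matrix (Fin d) (Fin rX) ℝ) (σX : Fin rX → ℝ) (VX : Matrix (Fin n) (Fin rX) ℝ)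
    (β μ γ γstar lam : ℝ)
    (hX : X = X₀ + C₀)
    (hX₀ : LRR.IsSVD X₀ U₀ σ₀ V₀)
    (hXsvd : LRR.IsSVD X UX σX VX)
    (hrank : X₀.rank = r₀) (hr₀ : 0 < r₀)
    (hsupp : Disjoint (LRR.colSupport X₀) (LRR.colSupport C₀))
    (hγ : γ = (LRR.colSupport C₀).card / n)
    (hβ : LRR.IsRWD X σX VX V₀ β)
    (hμ : LRR.IsColIncoherent V₀ γ μ)
    (hγstar : γstar / (1 - γstar) = 324 * β ^ 2 / (49 * (11 + 4 * β) ^ 2 * μ * r₀))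
    (hlam : lam = 3 / (7 * ‖X‖ * √(γstar * n)))
    (hle : γ ≤ γstar)
    (hrow : VX * VXᵀ * V₀ = V₀) :
    ∀ (Z : Matrix (Fin n) (Fin n) ℝ) (C : Matrix (Fin d) (Fin n) ℝ),
      LRR.IsOptimal X lam Z C →
        (∀ (r : ℕ) (U : Matrix (Fin n) (Fin r) ℝ) (σ : Fin r → ℝ) (V : Matrix (Fin n) (Fin r) ℝ),
          LRR.IsSVD Z U σ V → U * Uᵀ = V₀ * V₀ᵀ) ∧
        LRR.colSupport C = LRR.colSupport C₀ := by
  open LRR Matrix in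
  intro Z C hopt
  have hV : V₀ᵀ * V₀ = 1 := hX₀.right_orthonormal
  have hβ0 : 0 < β := hβ.1
  set I := colSupport C₀ with hI
  have hVI : ∀ i ∈ I, V₀ᵀ.col i = 0 := by
    intro i hi
    have h1 : X₀.col i = 0 := by
      by_contra h
      exact Finset.disjoint_left.1 hsupp (mem_colSupport.2 h) hi
    rw [hX₀.right_transpose_eq, col_mul, h1, mulVec_zero]
  have hVP : V₀ᵀ * coordProj I = 0 := by
    refine ext_of_col fun i => ?_
    by_cases hi : i ∈ I
    · rw [col_mul_coordProj_of_mem _ hi, hVI i hi]; rfl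
    · rw [col_mul_coordProj_of_notMem _ hi]; rfl
  have hV0 : V₀ᵀ ≠ 0 := by
    intro h
    rw [h, Matrix.zero_mul] at hV
    have := congrFun (congrFun hV ⟨0, hr₀⟩) ⟨0, hr₀⟩
    simp at this
  -- This nonzero column, available since `r₀ ≥ 1`, yields `‖X‖ > 0`, `n > 0`, `γ < 1` and `μ > 0`.
  obtain ⟨i₀, hi₀⟩ : ∃ i, V₀ᵀ.col i ≠ 0 := by
    by_contra! h
    exact hV0 (ext_of_col fun i => by rw [h i]; rfl)
  have hXpos : 0 < ‖X‖ := by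
    refine lt_of_le_of_ne (norm_nonneg _) fun h => hi₀ ?_
    rw [col_eq_mulVec_single]
    refine hXsvd.transpose_mulVec_eq_zero hrow ?_
    rw [norm_eq_zero.1 h.symm, zero_mulVec]
  have hn : (0 : ℝ) < n := by exact_mod_cast (Fin.pos i₀)
  have hr : (0 : ℝ) < r₀ := by exact_mod_cast hr₀
  have hcard : (I.card : ℝ) = γ * n := by rw [hγ]; field_simp
  have hγ1 : γ < 1 := by
    have h1 : I.card < n := by
      have : I.card < Fintype.card (Fin n) :=
        Finset.card_lt_univ_of_notMem fun hi => hi₀ (hVI i₀ hi)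
      simpa using this
    rw [hγ, div_lt_one hn]
    exact_mod_cast h1
  have h1γ : 0 < 1 - γ := by linarith
  have hμ0 : 0 < μ := by
    have h1 : 0 < colNorm V₀ᵀ i₀ ^ 2 := by
      have : colNorm V₀ᵀ i₀ ≠ 0 := fun h => hi₀ (colNorm_eq_zero.1 h)
      positivity
    have h2 := h1.trans_le (hμ i₀)
    rw [div_pos_iff_of_pos_right (by positivity)] at h2
    exact (pos_iff_pos_of_mul_pos h2).2 hr
  obtain ⟨hs0, hs1⟩ := pos_and_lt_one_of_div_one_sub_pos (a := γstar) (by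
    rw [hγstar]; positivity)
  have hsn : 0 < √(γstar * n) := Real.sqrt_pos.2 (by positivity)
  have hlam0 : 0 < lam := by rw [hlam]; positivity
  have hbd : lam * √(I.card) * ‖X‖ ≤ 3 / 7 := by
    have h1 : √(I.card) ≤ √(γstar * n) := by
      rw [hcard]; exact Real.sqrt_le_sqrt (mul_le_mul_of_nonneg_right hle hn.le)
    have h2 : lam * √(γstar * n) * ‖X‖ = 3 / 7 := by rw [hlam]; field_simp
    rw [← h2]
    exact mul_le_mul_of_nonneg_right (mul_le_mul_of_nonneg_left h1 hlam0.le) hXpos.le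
  have hinc : ∀ i, (61 + 21 * β) / (40 * β * ‖X‖) * colNorm V₀ᵀ i < lam := by
    intro i
    rw [hlam]
    refine certificate_bound_lt hβ0 hXpos hsn ?_
    rw [Real.sq_sqrt (by positivity)]
    -- Replacing `γ` by `γstar` in the incoherence bound brings in the ratio that defines `γstar`.
    have h1 : γstar / (1 - γ) ≤ γstar / (1 - γstar) :=
      div_le_div_of_nonneg_left hs0.le (by linarith) (by linarith)
    calc colNorm V₀ᵀ i ^ 2 * (γstar * n) ≤ μ * r₀ / ((1 - γ) * n) * (γstar * n) :=
          mul_le_mul_of_nonneg_right (hμ i) (by positivity)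
      _ = γstar / (1 - γ) * (μ * r₀) := by field_simp
      _ ≤ γstar / (1 - γstar) * (μ * r₀) := mul_le_mul_of_nonneg_right h1 (by positivity)
      _ = 324 * β ^ 2 / (49 * (11 + 4 * β) ^ 2) := by rw [hγstar]; field_simp
  obtain ⟨h1, h2, h3⟩ := recovery_of_bounds hX hX₀.mul_right_proj hV hVP hXsvd hXpos hβ hrow hlam0
    hbd hinc hopt
  exact ⟨fun r U σ V h => h.left_proj_eq h1 h2, h3⟩
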